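/- Let $\gamma\colon\mathbb R\to\mathbb R^2$ be a regular $C^3$ map (so $\gamma'\neq 0$ everywhere) that is periodic with period $L>0$ and injective on $[0,L)$, and let $\Gamma=\gamma(\mathbb R)$ be the simple closed curve it parametrizes, oriented by $\gamma$. Let $\kappa=\det(\gamma',\gamma'')/|\gamma'|^3$ be its signed curvature and $\dot\kappa$ the derivative of $\kappa$ with respect to arc length. Let $\sigma_\gamma=(\kappa,\dot\kappa)\colon\mathbb R\to\mathbb R^2$, and let $\sigma_\Gamma\colon\Gamma\to\mathbb R^2$ be the signature map, $\sigma_\Gamma\circ\gamma=\sigma_\gamma$; the signature of $\Gamma$ is $S_\Gamma=\sigma_\Gamma(\Gamma)$. Assume that $\Gamma$ is non-degenerate, i.e. the points of $\Gamma$ at which $\dot\kappa=0$ are isolated. A point $q\in S_\Gamma$ is called simple if some open set of the plane containing $q$ meets $S_\Gamma$ in a set homeomorphic to $\mathbb R$ or to a half-open interval, and a point of self-intersection otherwise. Assume that the set $Q$ of self-intersection points of $S_\Gamma$ is finite and non-empty. The edges of the signature quiver are the connected components of $S_\Gamma\setminus Q$. As $t$ runs through one period, $\sigma_\gamma$ traces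 a closed path of edges: every interval $(a,b)$ between two consecutive times of $\sigma_\gamma^{-1}(Q)$ with $a\in[0,L)$ contributes the edge $\sigma_\gamma((a,b))$. The multiplicity $\mu(E)$ of an edge $E$ is the number of times it occurs in this path. For $p\in\Gamma$ the local signature index of $\Gamma$ at $p$ is the cardinality of $\sigma_\Gamma^{-1}(\sigma_\Gamma(p))$, and the global signature index of $\Gamma$ is the minimum of the local ones over $p\in\Gamma$. A local symmetry of $\Gamma$ based at $p$ is a $g\in SE(2)$ for which there is an open $U\subset\mathbb R^2$ containing $p$ with $g\cdot(\Gamma\cap U)=\Gamma\cap(g\cdot U)$ as oriented sets (i.e. $g$ also carries the unit tangent vectors of $\Gamma$ at the points of $\Gamma\cap U$ to those of $\Gamma$ at the image points); the local symmetry index at $p$ is the number of these. Two pieces of $\Gamma$ are congruent if some $g\in SE(2)$ maps one onto the other preserving the orientations. Then there are finitely many edges $S_1,\dots,S_N$, each of them is an open curve segment (the image under $\sigma_\gamma$ of an open interval, homeomorphic to an open interval in the subspace topology), and for every $i$, with $\mu_i=\mu(S_i)$: 1. $\mu_i$ is finite, and $\sigma_\Gamma^{-1}(S_i)$ has exactly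 $\mu_i$ connected components; each of them is an open curve segment of $\Gamma$ (the image under $\gamma$ of an open interval, homeomorphic to an open interval), and any two of them are congruent. 2. At every point $p$ of these components, the local signature index and the local symmetry index of $\Gamma$ are both equal to $\mu_i$. Moreover, the global signature index of $\Gamma$ equals $\min_{1\le i\le N}\mu_i$. -/

import Mathlib

open Set

namespace PlaneCurve

/-- The Euclidean plane. -/
abbrev Plane : Type := EuclideanSpace ℝ (Fin 2)

/-- The determinant of the matrix with columns `u` and `v`. -/
def det2 (u v : Plane) : ℝ := u 0 * v 1 - u 1 * v 0

/-- The special Euclidean group: affine isometries of the plane whose linear part has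
determinant one, i.e. compositions of rotations and translations. -/
def SE2 : Set (Plane ≃ᵃⁱ[ℝ] Plane) :=
  {g | LinearMap.det (g.linearIsometryEquiv.toLinearEquiv : Plane →ₗ[ℝ] Plane) = 1}

/-- `γ` is a regular `C³` periodic parametrization of a simple closed curve, which it traverses
exactly once in each period `L`. -/
structure IsSimpleClosed (γ : ℝ → Plane) (L : ℝ) : Prop where
  contDiff : ContDiff ℝ 3 γ
  regular : ∀ t, deriv γ t ≠ 0
  pos : 0 < L
  periodic : Function.Periodic γ L
  injOn : InjOn γ (Ico 0 L)

section Signature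

/-- Signed Euclidean curvature of the parametrized curve `γ` at the parameter `t`. -/
noncomputable def curvature (γ : ℝ → Plane) (t : ℝ) : ℝ :=
  det2 (deriv γ t) (deriv (deriv γ) t) / ‖deriv γ t‖ ^ 3

/-- The derivative of the curvature with respect to arc length. -/
noncomputable def curvatureDot (γ : ℝ → Plane) (t : ℝ) : ℝ :=
  deriv (curvature γ) t / ‖deriv γ t‖

/-- The parametrized signature map `t ↦ (κ(t), κ̇(t))`. -/
noncomputable def paramSignature (γ : ℝ → Plane) (t : ℝ) : Plane :=
  !₂[curvature γ t, curvatureDot γ t]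

/-- The unit tangent vector at the parameter `t`. -/
noncomputable def paramTangent (γ : ℝ → Plane) (t : ℝ) : Plane :=
  ‖deriv γ t‖⁻¹ • deriv γ t

/-- The curve `Γ` as a subset of the plane. -/
def curve (γ : ℝ → Plane) : Set Plane := range γ

/-- The signature map `p ↦ (κ(p), κ̇(p))` on the points `p` of `Γ` (its value outside `Γ` is
irrelevant and never used). -/
noncomputable def signatureMap (γ : ℝ → Plane) (p : Plane) : Plane :=
  paramSignature γ (Function.invFun γ p)

/-- The unit tangent vector at the points `p` of `Γ`; it records the orientation of `Γ` (its
value outside `Γ` is irrelevant and never used). -/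
noncomputable def tangent (γ : ℝ → Plane) (p : Plane) : Plane :=
  paramTangent γ (Function.invFun γ p)

/-- The signature of `Γ`: the image of the signature map. -/
noncomputable def signature (γ : ℝ → Plane) : Set Plane := signatureMap γ '' curve γ

/-- The vertices of `Γ`: the points at which `κ̇` vanishes. -/
noncomputable def vertices (γ : ℝ → Plane) : Set Plane :=
  {p | p ∈ curve γ ∧ signatureMap γ p 1 = 0}

/-- `Γ` is non-degenerate: each of its vertices is isolated. -/
def IsNondegenerate (γ : ℝ → Plane) : Prop :=
  ∀ p ∈ vertices γ, ∃ U : Set Plane, IsOpen U ∧ U ∩ vertices γ = {p}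

end Signature

section WellDefined

variable {γ : ℝ → Plane} {L : ℝ}

theorem IsSimpleClosed.exists_int (h : IsSimpleClosed γ L) {s t : ℝ} (hst : γ s = γ t) :
    ∃ n : ℤ, s = t + n * L := by
  have hs := toIcoMod_mem_Ico h.pos 0 s
  have ht := toIcoMod_mem_Ico h.pos 0 t
  rw [zero_add] at hs ht
  have e : ∀ r, γ (toIcoMod h.pos 0 r) = γ r := fun r => by
    rw [toIcoMod, h.periodic.sub_zsmul_eq]
  have key := h.injOn hs ht (by rw [e, e, hst])
  refine ⟨toIcoDiv h.pos 0 s - toIcoDiv h.pos 0 t, ?_⟩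
  simp only [toIcoMod, zsmul_eq_mul] at key
  push_cast
  linarith

theorem periodic_deriv {E : Type*} [NormedAddCommGroup E] [NormedSpace ℝ E] {f : ℝ → E} {c : ℝ}
    (h : Function.Periodic f c) : Function.Periodic (deriv f) c := fun t => by
  rw [← deriv_comp_add_const, h.funext]

theorem periodic_curvature (h : Function.Periodic γ L) :
    Function.Periodic (curvature γ) L := fun t => by
  simp only [curvature, periodic_deriv h t, periodic_deriv (periodic_deriv h) t]

theorem periodic_paramSignature (h : Function.Periodic γ L) :
    Function.Periodic (paramSignature γ) L := fun t => by
  simp only [paramSignature, curvatureDot, periodic_curvature h t,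
    periodic_deriv (periodic_curvature h) t, periodic_deriv h t]

theorem periodic_paramTangent (h : Function.Periodic γ L) :
    Function.Periodic (paramTangent γ) L := fun t => by
  simp only [paramTangent, periodic_deriv h t]

/-- The signature map of a simple closed curve satisfies `σ_Γ ∘ γ = σ_γ`. -/
theorem IsSimpleClosed.signatureMap_apply (h : IsSimpleClosed γ L) (t : ℝ) :
    signatureMap γ (γ t) = paramSignature γ t := by
  obtain ⟨n, hn⟩ := h.exists_int (Function.invFun_eq (f := γ) ⟨t, rfl⟩)
  rw [signatureMap, hn]
  exact (periodic_paramSignature h.periodic).int_mul n t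

/-- The unit tangent field of a simple closed curve satisfies `T_Γ ∘ γ = T_γ`. -/
theorem IsSimpleClosed.tangent_apply (h : IsSimpleClosed γ L) (t : ℝ) :
    tangent γ (γ t) = paramTangent γ t := by
  obtain ⟨n, hn⟩ := h.exists_int (Function.invFun_eq (f := γ) ⟨t, rfl⟩)
  rw [tangent, hn]
  exact (periodic_paramTangent h.periodic).int_mul n t

end WellDefined

section Topology

/-- `p` is a simple point of `A`: some open set around `p` meets `A` in a set homeomorphic to the
line or to a half-open interval. -/
def IsSimplePoint (A : Set Plane) (p : Plane) : Prop :=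
  ∃ V : Set Plane, IsOpen V ∧ p ∈ V ∧
    (Nonempty (↥(V ∩ A) ≃ₜ ℝ) ∨ Nonempty (↥(V ∩ A) ≃ₜ ↥(Ico (0 : ℝ) 1)))

/-- The points of self-intersection of `A`: those that are not simple. -/
def selfIntersections (A : Set Plane) : Set Plane := {p | p ∈ A ∧ ¬ IsSimplePoint A p}

/-- The set of connected components of a subset `A` of the plane. -/
def components (A : Set Plane) : Set (Set Plane) := connectedComponentIn A '' A

/-- `A` is an open curve segment of the parametrized curve `c`: the image under `c` of an open
interval, homeomorphic to an open interval in the subspace topology. -/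
def IsOpenSegment (c : ℝ → Plane) (A : Set Plane) : Prop :=
  ∃ a b : ℝ, a < b ∧ A = c '' Ioo a b ∧ Nonempty (↥A ≃ₜ ↥(Ioo a b))

end Topology

section Indices

/-- The pieces `A` and `B` of the oriented curve `Γ` are congruent: some `g ∈ SE(2)` maps `A` onto
`B` and carries the orientation of `A` to that of `B`. -/
def Congruent (γ : ℝ → Plane) (A B : Set Plane) : Prop :=
  ∃ g ∈ SE2, g '' A = B ∧ ∀ q ∈ A, g.linearIsometryEquiv (tangent γ q) = tangent γ (g q)

/-- The local symmetries of the oriented curve `Γ` based at `p`: those `g ∈ SE(2)` such that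
`g · (Γ ∩ U) = Γ ∩ (g · U)`, as sets and with orientations, for some open `U` containing `p`. -/
def localSymmetries (γ : ℝ → Plane) (p : Plane) : Set (Plane ≃ᵃⁱ[ℝ] Plane) :=
  {g | g ∈ SE2 ∧ ∃ U : Set Plane, IsOpen U ∧ p ∈ U ∧
    g '' (curve γ ∩ U) = curve γ ∩ g '' U ∧
    ∀ q ∈ curve γ ∩ U, g.linearIsometryEquiv (tangent γ q) = tangent γ (g q)}

/-- The local symmetry index of `Γ` at `p`. -/
noncomputable def symIndexAt (γ : ℝ → Plane) (p : Plane) : ℕ∞ := (localSymmetries γ p).encard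

/-- The preimage `σ_Γ⁻¹(A)` of a set under the signature map of `Γ`. -/
noncomputable def signaturePreimage (γ : ℝ → Plane) (A : Set Plane) : Set Plane :=
  {q | q ∈ curve γ ∧ signatureMap γ q ∈ A}

/-- The local signature index of `Γ` at `p`. -/
noncomputable def sigIndexAt (γ : ℝ → Plane) (p : Plane) : ℕ∞ :=
  (signaturePreimage γ {signatureMap γ p}).encard

/-- The global signature index of `Γ`: the minimum of the local ones (the infimum is attained,
since `ℕ∞` is well-ordered and `Γ` is non-empty). -/
noncomputable def sigIndex (γ : ℝ → Plane) : ℕ∞ := ⨅ p ∈ curve γ, sigIndexAt γ p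

end Indices

section Quiver

/-- The vertices of the signature quiver of `Γ`: the self-intersections of the signature. -/
noncomputable def quiverVertices (γ : ℝ → Plane) : Set Plane := selfIntersections (signature γ)

/-- The edges of the signature quiver of `Γ`: the connected components of the complement of the
self-intersection points in the signature. -/
noncomputable def quiverEdges (γ : ℝ → Plane) : Set (Set Plane) :=
  components (signature γ \ quiverVertices γ)

/-- The passages of `Γ` along the edge `E` during one period: the pairs `a < b` of consecutive
times at which `σ_γ` is at a quiver vertex, with `0 ≤ a < L`, such that `σ_γ` traces out `E` on the
interval `(a, b)`. Listed in the order of `a`, the intervals of all edges give the closed path that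
`Γ` induces on its quiver. -/
def passages (γ : ℝ → Plane) (L : ℝ) (E : Set Plane) : Set (ℝ × ℝ) :=
  {I | I.1 ∈ Ico 0 L ∧ I.1 < I.2 ∧
    paramSignature γ I.1 ∈ quiverVertices γ ∧ paramSignature γ I.2 ∈ quiverVertices γ ∧
    (∀ t ∈ Ioo I.1 I.2, paramSignature γ t ∉ quiverVertices γ) ∧
    paramSignature γ '' Ioo I.1 I.2 = E}

/-- The multiplicity of the edge `E` induced by `Γ`: how often the closed path induced by `Γ`
contains `E`. -/
noncomputable def multiplicity (γ : ℝ → Plane) (L : ℝ) (E : Set Plane) : ℕ∞ :=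
  (passages γ L E).encard

end Quiver

end PlaneCurve

/-!
Parametrize `Γ` by arc length, by `c`. Then `σ ∘ c = (κ, κ')` consists of the values and the
derivatives of one function, and since the zeros of `κ'` are isolated it is locally injective. Near
a simple point of the signature it is thus, by the intermediate value theorem, open onto its image,
and whenever it comes back to a simple point it retraces the signature at the same pace, because
the second coordinate is the speed of the first: `σ (c (r + d)) = σ (c r)`. So the part of the path
between two consecutive visits to `Q` is an edge, and two passages along the same edge differ by a
translation in time.

A translation in time that preserves the curvature is induced by a rigid motion, by uniqueness for
the Frenet equations. Conversely, a rigid motion that preserves `Γ` near a point preserves arc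
length, so it acts as a translation in time, and it preserves the signature. Off the
self-intersections the points with the same signature, the passages along the edge and the local
symmetries are therefore all in bijection. Over a self-intersection the fibre can only be larger:
the passages along an edge that starts there start at distinct points of the fibre.
-/

namespace PlaneCurve

open Filter Topology

section Gap

/-- A gap of `Z`: the open interval between two consecutive elements of `Z`. The times between
two consecutive visits of a path to a set of vertices form a gap of the set of visits. -/
def IsGap {α : Type*} [Preorder α] (Z : Set α) (a b : α) : Prop :=
  a < b ∧ a ∈ Z ∧ b ∈ Z ∧ ∀ t ∈ Ioo a b, t ∉ Z

variable {α : Type*} [LinearOrder α] {Z : Set α} {a b a' b' t : α}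

theorem IsGap.le_of_lt (h : IsGap Z a b) (ht : t ∈ Z) (hat : a < t) : b ≤ t :=
  not_lt.1 fun htb => h.2.2.2 t ⟨hat, htb⟩ ht

theorem IsGap.eq_of_mem_Ico (h : IsGap Z a b) (h' : IsGap Z a' b') (ht : t ∈ Ico a b)
    (ht' : t ∈ Ico a' b') : a = a' ∧ b = b' := by
  have ha : a = a' := le_antisymm
    (not_lt.1 fun hlt => ((h'.le_of_lt h.2.1 hlt).trans ht.1).not_gt ht'.2)
    (not_lt.1 fun hlt => ((h.le_of_lt h'.2.1 hlt).trans ht'.1).not_gt ht.2)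
  subst ha
  exact ⟨rfl, le_antisymm (h.le_of_lt h'.2.2.1 h'.1) (h'.le_of_lt h.2.2.1 h.1)⟩

theorem exists_isGap_mem_Ico (ha : a ∈ Z) (hb : b ∈ Z) (hfin : (Z ∩ Icc a b).Finite)
    (ht : t ∈ Ico a b) : ∃ a' b', IsGap Z a' b' ∧ t ∈ Ico a' b' := by
  obtain ⟨a', ⟨ha'Z, -, ha't⟩, ha'max⟩ := (Z ∩ Icc a t).exists_max_image id
    (hfin.subset <| inter_subset_inter_right _ <| Icc_subset_Icc_right ht.2.le)
    ⟨a, ha, le_rfl, ht.1⟩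
  obtain ⟨b', ⟨hb'Z, htb', -⟩, hb'min⟩ := (Z ∩ Ioc t b).exists_min_image id
    (hfin.subset <| inter_subset_inter_right _ <|
      Ioc_subset_Icc_self.trans <| Icc_subset_Icc_left ht.1)
    ⟨b, hb, ht.2, le_rfl⟩
  refine ⟨a', b', ⟨ha't.trans_lt htb', ha'Z, hb'Z, fun r hr hrZ => ?_⟩, ha't, htb'⟩
  rcases le_or_gt r t with hrt | htr
  · exact hr.1.not_ge (ha'max r ⟨hrZ, (ha'max a ⟨ha, le_rfl, ht.1⟩).trans hr.1.le, hrt⟩)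
  · exact hr.2.not_ge (hb'min r ⟨hrZ, htr, hr.2.le.trans (hb'min b ⟨hb, ht.2, le_rfl⟩)⟩)

theorem IsGap.add_const {G : Type*} [AddCommGroup G] [LinearOrder G] [IsOrderedAddMonoid G]
    {Z : Set G} {a b d : G} (h : IsGap Z a b) (hd : ∀ t ∈ Icc a b, t + d ∈ Z ↔ t ∈ Z) :
    IsGap Z (a + d) (b + d) := by
  obtain ⟨hab, ha, hb, hZ⟩ := h
  refine ⟨by gcongr, (hd a ⟨le_rfl, hab.le⟩).2 ha, (hd b ⟨hab.le, le_rfl⟩).2 hb, fun t ht htZ => ?_⟩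
  have ht' : t - d ∈ Ioo a b := ⟨lt_sub_iff_add_lt.2 ht.1, sub_lt_iff_lt_add.2 ht.2⟩
  exact hZ _ ht' ((hd _ (Ioo_subset_Icc_self ht')).1 (by rwa [sub_add_cancel]))

end Gap

section Topology

theorem nhds_le_map_of_injOn {α δ : Type*} [ConditionallyCompleteLinearOrder α]
    [TopologicalSpace α] [OrderTopology α] [DenselyOrdered α] [NoMinOrder α] [NoMaxOrder α]
    [LinearOrder δ] [TopologicalSpace δ] [OrderTopology δ] {f : α → δ} {s : α} {N : Set α}
    (hN : N ∈ 𝓝 s) (hf : ContinuousOn f N) (hi : InjOn f N) : 𝓝 (f s) ≤ map f (𝓝 s) := by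
  intro W hW
  obtain ⟨a, b, ⟨has, hsb⟩, hab, hsub⟩ := exists_Icc_mem_subset_of_mem_nhds (inter_mem hW hN)
  obtain ⟨hsW, hsN⟩ := subset_inter_iff.1 hsub
  have hIoo := Icc_mem_nhds_iff.1 hab
  have hle := has.trans hsb
  refine mem_of_superset ?_ (image_subset_iff.2 hsW)
  rcases (hf.mono hsN).strictMonoOn_of_injOn_Icc' hle (hi.mono hsN) with hmono | hanti
  · exact mem_of_superset
      (Icc_mem_nhds (hmono (left_mem_Icc.2 hle) ⟨has, hsb⟩ hIoo.1)
        (hmono ⟨has, hsb⟩ (right_mem_Icc.2 hle) hIoo.2))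
      (intermediate_value_Icc hle (hf.mono hsN))
  · exact mem_of_superset
      (Icc_mem_nhds (hanti ⟨has, hsb⟩ (right_mem_Icc.2 hle) hIoo.2)
        (hanti (left_mem_Icc.2 hle) ⟨has, hsb⟩ hIoo.1))
      (intermediate_value_Icc' hle (hf.mono hsN))

variable {α X : Type*} [TopologicalSpace α] [TopologicalSpace X]

theorem nhdsWithin_le_map_of_nhds_le_map_comp {δ : Type*} [TopologicalSpace δ] {f : α → X}
    {e : X → δ} {B : Set X} {s : α} (he : ContinuousWithinAt e B (f s)) (hei : InjOn e B)
    (hfB : ∀ᶠ t in 𝓝 s, f t ∈ B) (ho : 𝓝 (e (f s)) ≤ map (e ∘ f) (𝓝 s)) :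
    𝓝[B] (f s) ≤ map f (𝓝 s) := by
  intro W hW
  have himage : (e ∘ f) '' (f ⁻¹' W ∩ f ⁻¹' B) ∈ 𝓝 (e (f s)) :=
    ho (image_mem_map (inter_mem hW hfB))
  filter_upwards [he himage, self_mem_nhdsWithin] with q hq hqB
  obtain ⟨t, ⟨htW, htB⟩, htq⟩ := hq
  exact hei htB hqB htq ▸ htW

theorem continuousOn_invFunOn_image [Nonempty α] [T2Space X] {f : α → X} {K : Set α}
    (hK : IsCompact K) (hf : ContinuousOn f K) (hi : InjOn f K) :
    ContinuousOn (Function.invFunOn f K) (f '' K) := by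
  refine continuousOn_iff_isClosed.2 fun Z hZ =>
    ⟨f '' (K ∩ Z), ((hK.inter_right hZ).image_of_continuousOn (hf.mono inter_subset_left)).isClosed,
      ?_⟩
  ext q
  refine and_congr_left ?_
  rintro ⟨x, hx, rfl⟩
  rw [mem_preimage, hi.leftInvOn_invFunOn hx, hi.mem_image_iff inter_subset_left hx]
  exact ⟨fun h => ⟨hx, h⟩, fun h => h.2⟩

theorem exists_continuousAt_lift [LocallyCompactSpace α] [T2Space X] {β : Type*}
    [TopologicalSpace β] {f : α → X} {h : β → X} {x : α} {t₀ : β} {N : Set α} (hN : N ∈ 𝓝 x)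
    (hf : Continuous f) (hi : InjOn f N) (ho : 𝓝[range f] (f x) ≤ map f (𝓝 x))
    (hh : Continuous h) (hr : ∀ᶠ t in 𝓝 t₀, h t ∈ range f) (h0 : h t₀ = f x) :
    ∃ φ : β → α, φ t₀ = x ∧ ∀ᶠ t in 𝓝 t₀, f (φ t) = h t ∧ ContinuousAt φ t := by
  obtain ⟨K, hKx, hKN, hK⟩ := local_compact_nhds hN
  have : Nonempty α := ⟨x⟩
  have hlift : Tendsto h (𝓝 t₀) (𝓝[range f] (f x)) :=
    tendsto_nhdsWithin_iff.2 ⟨h0 ▸ hh.continuousAt, hr⟩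
  have hhK : ∀ᶠ t in 𝓝 t₀, h t ∈ f '' K := hlift (ho (image_mem_map hKx))
  refine ⟨fun t => Function.invFunOn f K (h t), ?_, ?_⟩
  · simpa only [h0] using (hi.mono hKN).leftInvOn_invFunOn (mem_of_mem_nhds hKx)
  · filter_upwards [hhK.eventually_nhds] with t ht
    refine ⟨Function.invFunOn_eq ht.self_of_nhds, Tendsto.comp
      (continuousOn_invFunOn_image hK hf.continuousOn (hi.mono hKN) _ ht.self_of_nhds)
      (tendsto_nhdsWithin_iff.2 ⟨hh.continuousAt, ht⟩)⟩

theorem nonempty_homeomorph_image {f : α → X} {I : Set α} (hf : ContinuousOn f I)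
    (hi : InjOn f I) (ho : ∀ s ∈ I, 𝓝[f '' I] (f s) ≤ map f (𝓝[I] s)) :
    Nonempty (↥(f '' I) ≃ₜ ↥I) := by
  let e : ↥I ≃ ↥(f '' I) := Equiv.Set.imageOfInjOn f I hi
  refine ⟨(e.toHomeomorphOfContinuousOpen (hf.domRestrict.subtype_mk _) ?_).symm⟩
  refine isOpenMap_iff_nhds_le.2 fun x W hW => ?_
  rw [mem_map, mem_nhds_subtype_iff_nhdsWithin] at hW
  rw [mem_nhds_subtype_iff_nhdsWithin]
  refine mem_of_superset (ho x x.2 (image_mem_map hW)) ?_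
  rintro _ ⟨_, ⟨y, hy, rfl⟩, rfl⟩
  exact ⟨e y, hy, rfl⟩

theorem finite_inter_preimage_of_injOn_nhds {β : Type*} {f : α → β} {K : Set α} {Q : Set β}
    (hK : IsCompact K) (hf : ∀ x ∈ K, ∃ N ∈ 𝓝 x, InjOn f N) (hQ : Q.Finite) :
    (K ∩ f ⁻¹' Q).Finite := by
  choose! N hN hi using hf
  obtain ⟨t, htK, hKt⟩ := hK.elim_nhds_subcover N hN
  have hfin : (⋃ x ∈ t, N x ∩ f ⁻¹' Q).Finite := t.finite_toSet.biUnion fun x hx =>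
    Finite.of_finite_image (hQ.subset (image_subset_iff.2 inter_subset_right))
      ((hi x (htK x hx)).mono inter_subset_left)
  refine hfin.subset ?_
  rw [← iUnion₂_inter]
  exact inter_subset_inter_left _ hKt

theorem connectedComponentIn_sUnion_eq {F : Set (Set X)} (hd : F.PairwiseDisjoint id)
    (hc : ∀ A ∈ F, IsPreconnected A) (ho : ∀ A ∈ F, ∀ q ∈ A, A ∈ 𝓝[⋃₀ F] q) {A : Set X}
    (hA : A ∈ F) {q : X} (hq : q ∈ A) : connectedComponentIn (⋃₀ F) q = A := by
  have hAF : A ⊆ ⋃₀ F := subset_sUnion_of_mem hA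
  refine Subset.antisymm ?_ ((hc A hA).subset_connectedComponentIn hq hAF)
  have hclopen : IsClopen ((↑) ⁻¹' A : Set ↥(⋃₀ F)) := by
    constructor
    · refine isOpen_compl_iff.1 (isOpen_iff_mem_nhds.2 fun ⟨z, B, hB, hzB⟩ hzA => ?_)
      refine mem_of_superset (preimage_coe_mem_nhds_subtype.2 (ho B hB z hzB))
        fun w hwB hwA => hzA ?_
      have hBA : B = A := hd.elim_set hB hA w hwB hwA
      exact hBA ▸ hzB
    · exact isOpen_iff_mem_nhds.2 fun z hz => preimage_coe_mem_nhds_subtype.2 (ho A hA z hz)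
  rw [connectedComponentIn_eq_image (hAF hq)]
  exact image_subset_iff.2 (hclopen.connectedComponent_subset hq)

theorem image_connectedComponentIn_sUnion {F : Set (Set X)} (hd : F.PairwiseDisjoint id)
    (hne : ∀ A ∈ F, A.Nonempty) (hc : ∀ A ∈ F, IsPreconnected A)
    (ho : ∀ A ∈ F, ∀ q ∈ A, A ∈ 𝓝[⋃₀ F] q) : connectedComponentIn (⋃₀ F) '' ⋃₀ F = F := by
  ext A
  constructor
  · rintro ⟨q, ⟨B, hB, hqB⟩, rfl⟩
    rwa [connectedComponentIn_sUnion_eq hd hc ho hB hqB]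
  · intro hA
    obtain ⟨q, hq⟩ := hne A hA
    exact ⟨q, ⟨A, hA, hq⟩, connectedComponentIn_sUnion_eq hd hc ho hA hq⟩

end Topology

section SimpleLoop

/-- `c` runs through a simple loop once in each period `P`: the values of `c` at two times agree
only if the times differ by a multiple of `P`. -/
structure IsSimpleLoop {Y : Type*} [TopologicalSpace Y] (c : ℝ → Y) (P : ℝ) : Prop where
  pos : 0 < P
  continuous : Continuous c
  periodic : Function.Periodic c P
  exists_int : ∀ {s t : ℝ}, c s = c t → ∃ n : ℤ, s = t + n * P

namespace IsSimpleLoop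

variable {Y : Type*} [TopologicalSpace Y] {c : ℝ → Y} {P : ℝ}

theorem injOn_Ico (h : IsSimpleLoop c P) (a : ℝ) : InjOn c (Ico a (a + P)) := by
  intro s hs t ht hst
  have : Fact (0 < P) := ⟨h.pos⟩
  obtain ⟨n, rfl⟩ := h.exists_int hst
  rw [← AddCircle.coe_eq_coe_iff_of_mem_Ico hs ht]
  simp [← zsmul_eq_mul]

theorem injOn_nhds (h : IsSimpleLoop c P) (s : ℝ) : ∃ N ∈ 𝓝 s, InjOn c N :=
  ⟨Ico (s - P / 2) (s - P / 2 + P), Ico_mem_nhds (by linarith [h.pos]) (by linarith [h.pos]),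
    h.injOn_Ico _⟩

theorem map_nhds_eq [T2Space Y] (h : IsSimpleLoop c P) (s : ℝ) :
    map c (𝓝 s) = 𝓝[range c] (c s) := by
  have : Fact (0 < P) := ⟨h.pos⟩
  let lift : AddCircle P → Y := h.periodic.lift
  have hcont : Continuous lift := h.continuous.quotient_lift _
  have hinj : Function.Injective lift := by
    intro x y
    induction x using QuotientAddGroup.induction_on with | H s => ?_
    induction y using QuotientAddGroup.induction_on with | H t => ?_
    intro hst
    obtain ⟨n, rfl⟩ := h.exists_int hst
    simp [← zsmul_eq_mul]
  calc map c (𝓝 s) = map lift (𝓝 (s : AddCircle P)) := by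
        rw [← QuotientAddGroup.isOpenQuotientMap_mk.map_nhds_eq s, map_map]; rfl
    _ = 𝓝[range lift] (lift (s : AddCircle P)) :=
        (hcont.isClosedEmbedding hinj).isEmbedding.map_nhds_eq _
    _ = 𝓝[range c] (c s) :=
        congrArg (fun A => 𝓝[A] (c s)) (QuotientAddGroup.mk_surjective.range_comp lift).symm

theorem nonempty_homeomorph_image_Ioo [T2Space Y] (h : IsSimpleLoop c P) {a b : ℝ}
    (hba : b ≤ a + P) : Nonempty (↥(c '' Ioo a b) ≃ₜ ↥(Ioo a b)) :=
  nonempty_homeomorph_image h.continuous.continuousOn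
    ((h.injOn_Ico a).mono (Ioo_subset_Ico_self.trans (Ico_subset_Ico_right hba))) fun s hs => by
    rw [isOpen_Ioo.nhdsWithin_eq hs, h.map_nhds_eq]
    exact nhdsWithin_mono _ (image_subset_range _ _)

end IsSimpleLoop

end SimpleLoop

section EdgePath

variable {X : Type*}

/-- The passages along `E` of a path `σ` of period `P` with vertex set `Q`: the gaps between its
visits to `Q` that start in `[0, P)` and are mapped onto `E`. -/
def pathPassages (σ : ℝ → X) (Q : Set X) (P : ℝ) (E : Set X) : Set (ℝ × ℝ) :=
  {I | I.1 ∈ Ico 0 P ∧ IsGap (σ ⁻¹' Q) I.1 I.2 ∧ σ '' Ioo I.1 I.2 = E}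

theorem IsSimpleLoop.injOn_pathPassages {Y : Type*} [TopologicalSpace Y] {c : ℝ → Y} {P : ℝ}
    {σ : ℝ → X} {Q E : Set X} (hc : IsSimpleLoop c P) (d : ℝ) :
    InjOn (fun I : ℝ × ℝ => c (I.1 + d)) (pathPassages σ Q P E) := by
  rintro I ⟨hI, hg, -⟩ I' ⟨hI', hg', -⟩ hII'
  obtain ⟨n, hn⟩ := hc.exists_int hII'
  have hfst : I.1 = I'.1 := hc.injOn_Ico 0 (by simpa using hI) (by simpa using hI') (by
    rw [← hc.periodic.int_mul n I'.1]
    exact congrArg c (by linarith))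
  exact Prod.ext hfst
    (hg.eq_of_mem_Ico hg' ⟨le_rfl, hg.1⟩ ⟨hfst.ge, hfst ▸ hg'.1⟩).2

/-- `σ` is a closed path of edges on a quiver with vertex set `Q`: it is at a vertex at discrete
times, and off the vertices it is open onto its image and, whenever it comes back to a point, runs
through a neighbourhood of this point at the same pace as before. -/
structure IsEdgePath [TopologicalSpace X] (σ : ℝ → X) (Q : Set X) (P : ℝ) : Prop where
  pos : 0 < P
  continuous : Continuous σ
  periodic : Function.Periodic σ P
  finite_visits : ∀ a b, (σ ⁻¹' Q ∩ Icc a b).Finite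
  nonempty_visits : (σ ⁻¹' Q).Nonempty
  nhdsWithin_range_le : ∀ {s}, σ s ∉ Q → 𝓝[range σ] (σ s) ≤ map σ (𝓝 s)
  retrace : ∀ {s d}, σ s ∉ Q → σ (s + d) = σ s → ∀ᶠ r in 𝓝 s, σ (r + d) = σ r

namespace IsEdgePath

variable [TopologicalSpace X] {σ : ℝ → X} {Q : Set X} {P a b a' b' s s' t d : ℝ} {E : Set X}
  {I I' : ℝ × ℝ}

theorem exists_isGap_mem_Ico (h : IsEdgePath σ Q P) (t : ℝ) :
    ∃ a b, IsGap (σ ⁻¹' Q) a b ∧ t ∈ Ico a b := by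
  obtain ⟨z, hz⟩ := h.nonempty_visits
  obtain ⟨n, ⟨hlt, hle⟩, -⟩ := existsUnique_add_zsmul_mem_Ioc h.pos z (t - P)
  have hn : z + n • P ∈ σ ⁻¹' Q := by rwa [mem_preimage, h.periodic.zsmul n z]
  exact PlaneCurve.exists_isGap_mem_Ico hn (b := z + n • P + P)
    (by rwa [mem_preimage, h.periodic]) (h.finite_visits _ _)
      ⟨by rwa [sub_add_cancel] at hle, sub_lt_iff_lt_add.1 hlt⟩

theorem exists_isGap_mem_Ioo (h : IsEdgePath σ Q P) (ht : σ t ∉ Q) :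
    ∃ a b, IsGap (σ ⁻¹' Q) a b ∧ t ∈ Ioo a b := by
  obtain ⟨a, b, hg, hat, htb⟩ := h.exists_isGap_mem_Ico t
  exact ⟨a, b, hg, hat.lt_of_ne fun hat => ht (hat ▸ hg.2.1), htb⟩

theorem exists_mem_pathPassages (h : IsEdgePath σ Q P) (hg : IsGap (σ ⁻¹' Q) a b) :
    ∃ n : ℤ, (a + n * P, b + n * P) ∈ pathPassages σ Q P (σ '' Ioo a b) := by
  obtain ⟨n, hn, -⟩ := existsUnique_add_zsmul_mem_Ico h.pos a 0
  rw [zsmul_eq_mul, zero_add] at hn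
  have hσ : ∀ t, σ (t + n * P) = σ t := h.periodic.int_mul n
  refine ⟨n, hn, hg.add_const fun t _ => ?_, ?_⟩
  · rw [mem_preimage, hσ, mem_preimage]
  · simp only [← image_add_const_Ioo, image_image, hσ]

theorem nonempty_pathPassages_iff (h : IsEdgePath σ Q P) :
    (pathPassages σ Q P E).Nonempty ↔ ∃ a b, IsGap (σ ⁻¹' Q) a b ∧ σ '' Ioo a b = E := by
  constructor
  · rintro ⟨I, -, hI⟩
    exact ⟨I.1, I.2, hI⟩
  · rintro ⟨a, b, hg, rfl⟩
    exact ⟨_, (h.exists_mem_pathPassages hg).choose_spec⟩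

theorem finite_gaps (h : IsEdgePath σ Q P) :
    {I : ℝ × ℝ | I.1 ∈ Ico 0 P ∧ IsGap (σ ⁻¹' Q) I.1 I.2}.Finite := by
  refine Finite.of_finite_image (f := Prod.fst) ((h.finite_visits 0 P).subset ?_) ?_
  · rintro _ ⟨I, ⟨hI, hg⟩, rfl⟩
    exact ⟨hg.2.1, Ico_subset_Icc_self hI⟩
  · rintro ⟨a, b⟩ ⟨-, hg⟩ ⟨a', b'⟩ ⟨-, hg'⟩ rfl
    exact Prod.ext rfl (hg.eq_of_mem_Ico hg' ⟨le_rfl, hg.1⟩ ⟨le_rfl, hg'.1⟩).2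

theorem finite_pathPassages (h : IsEdgePath σ Q P) (E : Set X) : (pathPassages σ Q P E).Finite :=
  h.finite_gaps.subset fun _ hI => ⟨hI.1, hI.2.1⟩

theorem finite_edges (h : IsEdgePath σ Q P) : {E | (pathPassages σ Q P E).Nonempty}.Finite :=
  (h.finite_gaps.image fun I => σ '' Ioo I.1 I.2).subset fun _ ⟨I, hI, hg, hE⟩ => ⟨I, ⟨hI, hg⟩, hE⟩

theorem gap_le_add_period (h : IsEdgePath σ Q P) (hg : IsGap (σ ⁻¹' Q) a b) : b ≤ a + P :=
  hg.le_of_lt (by rw [mem_preimage, h.periodic]; exact hg.2.1) (lt_add_of_pos_right a h.pos)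

theorem image_Ioo_mem_nhdsWithin (h : IsEdgePath σ Q P) (hg : IsGap (σ ⁻¹' Q) a b)
    (hs : s ∈ Ioo a b) : σ '' Ioo a b ∈ 𝓝[range σ] (σ s) :=
  h.nhdsWithin_range_le (hg.2.2.2 s hs) (image_mem_map (Ioo_mem_nhds hs.1 hs.2))

theorem sUnion_edges (h : IsEdgePath σ Q P) :
    ⋃₀ {E | (pathPassages σ Q P E).Nonempty} = range σ \ Q := by
  ext q
  constructor
  · rintro ⟨_, ⟨I, -, hg, rfl⟩, s, hs, rfl⟩
    exact ⟨mem_range_self s, hg.2.2.2 s hs⟩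
  · rintro ⟨⟨s, rfl⟩, hs⟩
    obtain ⟨a, b, hg, hsab⟩ := h.exists_isGap_mem_Ioo hs
    exact ⟨_, h.nonempty_pathPassages_iff.2 ⟨a, b, hg, rfl⟩, mem_image_of_mem σ hsab⟩

variable [T2Space X]

theorem add_eq (h : IsEdgePath σ Q P) (hg : IsGap (σ ⁻¹' Q) a b) (hs : s ∈ Ioo a b)
    (hsd : σ (s + d) = σ s) : ∀ r ∈ Icc a b, σ (r + d) = σ r := by
  have hclosed : IsClosed {r | σ (r + d) = σ r} :=
    isClosed_eq (h.continuous.comp (continuous_add_const d)) h.continuous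
  have hIoo : Ioo a b ⊆ {r | ∀ᶠ r' in 𝓝 r, σ (r' + d) = σ r'} := by
    refine isPreconnected_Ioo.subset_of_closure_inter_subset isOpen_setOfPred_eventually_nhds
      ⟨s, hs, h.retrace (hg.2.2.2 s hs) hsd⟩ ?_
    rintro r ⟨hr, hrab⟩
    exact h.retrace (hg.2.2.2 r hrab)
      (closure_minimal (fun _ hr' => hr'.self_of_nhds) hclosed hr)
  rw [← closure_Ioo hg.1.ne]
  exact closure_minimal (fun r hr => (hIoo hr).self_of_nhds) hclosed

theorem eq_add_of_apply_eq (h : IsEdgePath σ Q P) (hg : IsGap (σ ⁻¹' Q) a b)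
    (hg' : IsGap (σ ⁻¹' Q) a' b') (hs : s ∈ Ioo a b) (hs' : s' ∈ Ioo a' b')
    (hss' : σ s' = σ s) : a' = a + (s' - s) ∧ b' = b + (s' - s) := by
  have hadd := h.add_eq hg hs (d := s' - s) (by rwa [add_sub_cancel])
  refine hg'.eq_of_mem_Ico (hg.add_const fun t ht => ?_) (Ioo_subset_Ico_self hs') ?_
  · rw [mem_preimage, hadd t ht, mem_preimage]
  · constructor <;> linarith [hs.1, hs.2]

theorem injOn_Ioo (h : IsEdgePath σ Q P) (hg : IsGap (σ ⁻¹' Q) a b) : InjOn σ (Ioo a b) :=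
  fun s hs s' hs' hss' => by linarith [(h.eq_add_of_apply_eq hg hg hs' hs hss').1]

theorem image_Ioo_eq (h : IsEdgePath σ Q P) (hg : IsGap (σ ⁻¹' Q) a b)
    (hg' : IsGap (σ ⁻¹' Q) a' b') (hs : s ∈ Ioo a b) (hs' : s' ∈ Ioo a' b')
    (hss' : σ s' = σ s) : σ '' Ioo a' b' = σ '' Ioo a b := by
  obtain ⟨rfl, rfl⟩ := h.eq_add_of_apply_eq hg hg' hs hs' hss'
  rw [← image_add_const_Ioo, image_image]
  exact image_congr fun r hr =>
    h.add_eq hg hs (by rwa [add_sub_cancel]) r (Ioo_subset_Icc_self hr)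

theorem exists_eq_add_of_mem_pathPassages (h : IsEdgePath σ Q P) (hg : IsGap (σ ⁻¹' Q) a b)
    (hI : I ∈ pathPassages σ Q P (σ '' Ioo a b)) :
    ∃ d, I = (a + d, b + d) ∧ ∀ r ∈ Icc a b, σ (r + d) = σ r := by
  obtain ⟨-, hgI, hE⟩ := hI
  obtain ⟨s', hs'⟩ := nonempty_Ioo.2 hgI.1
  obtain ⟨s, hs, hss'⟩ := hE ▸ mem_image_of_mem σ hs'
  obtain ⟨hI₁, hI₂⟩ := h.eq_add_of_apply_eq hg hgI hs hs' hss'.symm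
  exact ⟨s' - s, Prod.ext hI₁ hI₂, h.add_eq hg hs (by rw [add_sub_cancel, hss'])⟩

theorem nonempty_homeomorph_image_Ioo (h : IsEdgePath σ Q P) (hg : IsGap (σ ⁻¹' Q) a b) :
    Nonempty (↥(σ '' Ioo a b) ≃ₜ ↥(Ioo a b)) :=
  nonempty_homeomorph_image h.continuous.continuousOn (h.injOn_Ioo hg) fun s hs => by
    rw [isOpen_Ioo.nhdsWithin_eq hs]
    exact (nhdsWithin_mono _ (image_subset_range _ _)).trans
      (h.nhdsWithin_range_le (hg.2.2.2 s hs))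

theorem pairwiseDisjoint_edges (h : IsEdgePath σ Q P) :
    {E | (pathPassages σ Q P E).Nonempty}.PairwiseDisjoint id := by
  rintro _ ⟨I, -, hg, rfl⟩ _ ⟨I', -, hg', rfl⟩ hne
  refine disjoint_left.2 ?_
  rintro _ ⟨s, hs, rfl⟩ ⟨s', hs', hss'⟩
  exact hne (h.image_Ioo_eq hg' hg hs' hs hss'.symm)

theorem image_connectedComponentIn (h : IsEdgePath σ Q P) :
    connectedComponentIn (range σ \ Q) '' (range σ \ Q) =
      {E | (pathPassages σ Q P E).Nonempty} := by
  rw [← h.sUnion_edges]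
  refine image_connectedComponentIn_sUnion h.pairwiseDisjoint_edges ?_ ?_ ?_ <;>
    rintro _ ⟨I, -, hg, rfl⟩
  · exact (nonempty_Ioo.2 hg.1).image σ
  · exact isPreconnected_Ioo.image σ h.continuous.continuousOn
  · rintro _ ⟨s, hs, rfl⟩
    rw [h.sUnion_edges]
    exact nhdsWithin_mono _ sdiff_subset (h.image_Ioo_mem_nhdsWithin hg hs)

section SimpleLoop

variable {Y : Type*} {c : ℝ → Y} {τ : Y → X}

theorem sUnion_image_passages (h : IsEdgePath (τ ∘ c) Q P) (hc : Function.Periodic c P)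
    (hE : (pathPassages (τ ∘ c) Q P E).Nonempty) :
    ⋃₀ ((fun I => c '' Ioo I.1 I.2) '' pathPassages (τ ∘ c) Q P E) = range c ∩ τ ⁻¹' E := by
  ext q
  constructor
  · rintro ⟨_, ⟨I, hI, rfl⟩, s, hs, rfl⟩
    exact ⟨mem_range_self s, hI.2.2 ▸ mem_image_of_mem (τ ∘ c) hs⟩
  · rintro ⟨⟨t, rfl⟩, ht⟩
    obtain ⟨I, -, hg, rfl⟩ := hE
    obtain ⟨s, hs, hst⟩ := ht
    obtain ⟨a, b, hgt, htab⟩ := h.exists_isGap_mem_Ioo (t := t) (by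
      rw [Function.comp_apply, ← hst]; exact hg.2.2.2 s hs)
    obtain ⟨n, hn⟩ := h.exists_mem_pathPassages hgt
    rw [h.image_Ioo_eq hg hgt hs htab hst.symm] at hn
    refine ⟨_, mem_image_of_mem _ hn, t + n * P, ?_, hc.int_mul n t⟩
    exact ⟨add_lt_add_left htab.1 _, add_lt_add_left htab.2 _⟩

theorem mapsTo_fibre (h : IsEdgePath (τ ∘ c) Q P) (hg : IsGap (τ ∘ c ⁻¹' Q) a b)
    (hs : s ∈ Icc a b) :
    MapsTo (fun I : ℝ × ℝ => c (I.1 + (s - a))) (pathPassages (τ ∘ c) Q P (τ ∘ c '' Ioo a b))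
      (range c ∩ τ ⁻¹' {τ (c s)}) := by
  intro I hI
  obtain ⟨d, rfl, hd⟩ := h.exists_eq_add_of_mem_pathPassages hg hI
  refine ⟨mem_range_self _, ?_⟩
  have hsd : a + d + (s - a) = s + d := by ring
  exact (congrArg (τ ∘ c) hsd).trans (hd s hs)

theorem surjOn_fibre (h : IsEdgePath (τ ∘ c) Q P) (hc : Function.Periodic c P)
    (hg : IsGap (τ ∘ c ⁻¹' Q) a b) (hs : s ∈ Ioo a b) :
    SurjOn (fun I : ℝ × ℝ => c (I.1 + (s - a))) (pathPassages (τ ∘ c) Q P (τ ∘ c '' Ioo a b))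
      (range c ∩ τ ⁻¹' {τ (c s)}) := by
  rintro _ ⟨⟨t, rfl⟩, hts : τ (c t) = τ (c s)⟩
  obtain ⟨a', b', hg', ht⟩ := h.exists_isGap_mem_Ioo (t := t) (by
    rw [Function.comp_apply, hts]; exact hg.2.2.2 s hs)
  obtain ⟨n, hn⟩ := h.exists_mem_pathPassages hg'
  refine ⟨_, h.image_Ioo_eq hg hg' hs ht hts ▸ hn, ?_⟩
  rw [← hc.int_mul n t]
  exact congrArg c (by linarith [(h.eq_add_of_apply_eq hg hg' hs ht hts).1])

variable [TopologicalSpace Y]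

theorem eq_of_apply_eq (h : IsEdgePath (τ ∘ c) Q P) (hc : IsSimpleLoop c P) {E' : Set X}
    (hI : I ∈ pathPassages (τ ∘ c) Q P E) (hI' : I' ∈ pathPassages (τ ∘ c) Q P E')
    (hs : s ∈ Ioo I.1 I.2) (hs' : s' ∈ Ioo I'.1 I'.2) (hss' : c s' = c s) : I' = I := by
  obtain ⟨n, hn⟩ := hc.exists_int hss'
  obtain ⟨h₁, h₂⟩ := h.eq_add_of_apply_eq hI.2.1 hI'.2.1 hs hs' (congrArg τ hss')
  rw [hn, add_sub_cancel_left] at h₁ h₂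
  have hfst : I'.1 = I.1 := hc.injOn_Ico 0 (by simpa using hI'.1) (by simpa using hI.1)
    (by rw [h₁]; exact hc.periodic.int_mul n I.1)
  exact Prod.ext hfst (by linarith)

theorem image_connectedComponentIn_preimage [T2Space Y] (h : IsEdgePath (τ ∘ c) Q P)
    (hc : IsSimpleLoop c P) (hE : (pathPassages (τ ∘ c) Q P E).Nonempty) :
    connectedComponentIn (range c ∩ τ ⁻¹' E) '' (range c ∩ τ ⁻¹' E) =
      (fun I => c '' Ioo I.1 I.2) '' pathPassages (τ ∘ c) Q P E := by
  rw [← h.sUnion_image_passages hc.periodic hE]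
  refine image_connectedComponentIn_sUnion ?_ ?_ ?_ ?_
  · rintro _ ⟨I, hI, rfl⟩ _ ⟨I', hI', rfl⟩ hne
    refine disjoint_left.2 ?_
    rintro _ ⟨s, hs, rfl⟩ ⟨s', hs', hss'⟩
    exact hne (by rw [h.eq_of_apply_eq hc hI hI' hs hs' hss'])
  · rintro _ ⟨I, hI, rfl⟩
    exact (nonempty_Ioo.2 hI.2.1.1).image c
  · rintro _ ⟨I, -, rfl⟩
    exact isPreconnected_Ioo.image c hc.continuous.continuousOn
  · rintro _ ⟨I, -, rfl⟩ _ ⟨s, hs, rfl⟩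
    rw [h.sUnion_image_passages hc.periodic hE]
    exact nhdsWithin_mono _ inter_subset_left
      (hc.map_nhds_eq s ▸ image_mem_map (Ioo_mem_nhds hs.1 hs.2))

theorem injOn_image_Ioo (h : IsEdgePath (τ ∘ c) Q P) (hc : IsSimpleLoop c P) :
    InjOn (fun I : ℝ × ℝ => c '' Ioo I.1 I.2) (pathPassages (τ ∘ c) Q P E) := by
  intro I hI I' hI' hII'
  obtain ⟨s, hs⟩ := nonempty_Ioo.2 hI.2.1.1
  obtain ⟨s', hs', hss'⟩ := hII'.subset (mem_image_of_mem c hs)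
  exact h.eq_of_apply_eq hc hI' hI hs' hs hss'.symm

theorem encard_pathPassages_le (h : IsEdgePath (τ ∘ c) Q P) (hc : IsSimpleLoop c P)
    (hg : IsGap (τ ∘ c ⁻¹' Q) a b) (hs : s ∈ Icc a b) :
    (pathPassages (τ ∘ c) Q P (τ ∘ c '' Ioo a b)).encard ≤ (range c ∩ τ ⁻¹' {τ (c s)}).encard :=
  encard_le_encard_of_injOn (h.mapsTo_fibre hg hs) (hc.injOn_pathPassages _)

theorem encard_fibre_eq (h : IsEdgePath (τ ∘ c) Q P) (hc : IsSimpleLoop c P)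
    (hg : IsGap (τ ∘ c ⁻¹' Q) a b) (hs : s ∈ Ioo a b) :
    (range c ∩ τ ⁻¹' {τ (c s)}).encard = (pathPassages (τ ∘ c) Q P (τ ∘ c '' Ioo a b)).encard := by
  rw [← (hc.injOn_pathPassages (s - a)).encard_image]
  exact congrArg encard ((h.surjOn_fibre hc.periodic hg hs).antisymm
    (h.mapsTo_fibre hg (Ioo_subset_Icc_self hs)).image_subset)

theorem isLeast_iInf_encard_fibre (h : IsEdgePath (τ ∘ c) Q P) (hc : IsSimpleLoop c P) :
    IsLeast ((fun E => (pathPassages (τ ∘ c) Q P E).encard) ''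
        {E | (pathPassages (τ ∘ c) Q P E).Nonempty})
      (⨅ p ∈ range c, (range c ∩ τ ⁻¹' {τ p}).encard) := by
  set S := (fun E => (pathPassages (τ ∘ c) Q P E).encard) ''
    {E | (pathPassages (τ ∘ c) Q P E).Nonempty}
  have hmem : ∀ {a b}, IsGap (τ ∘ c ⁻¹' Q) a b →
      (pathPassages (τ ∘ c) Q P (τ ∘ c '' Ioo a b)).encard ∈ S := fun hg =>
    mem_image_of_mem _ (h.nonempty_pathPassages_iff.2 ⟨_, _, hg, rfl⟩)
  have hinf : ⨅ p ∈ range c, (range c ∩ τ ⁻¹' {τ p}).encard = sInf S := by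
    apply le_antisymm
    · refine le_sInf ?_
      rintro _ ⟨_, ⟨I, -, hg, rfl⟩, rfl⟩
      obtain ⟨s, hs⟩ := nonempty_Ioo.2 hg.1
      exact (iInf₂_le (c s) (mem_range_self s)).trans (h.encard_fibre_eq hc hg hs).le
    · refine le_iInf₂ ?_
      rintro _ ⟨s, rfl⟩
      obtain ⟨a, b, hg, hs⟩ := h.exists_isGap_mem_Ico s
      exact (sInf_le (hmem hg)).trans
        (h.encard_pathPassages_le hc hg (Ico_subset_Icc_self hs))
  obtain ⟨a, b, hg, -⟩ := h.exists_isGap_mem_Ico 0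
  exact hinf ▸ isLeast_csInf ⟨_, hmem hg⟩

end SimpleLoop

end IsEdgePath

end EdgePath

section Calculus

variable {E : Type*} [NormedAddCommGroup E] [NormedSpace ℝ E]

theorem hasDerivAt_of_hasDerivAt_comp {c : ℝ → E} {φ : ℝ → ℝ} {v : E} {a t : ℝ}
    (hc : HasDerivAt c v (φ t)) (hv : v ≠ 0) (hφ : ContinuousAt φ t)
    (hcφ : HasDerivAt (c ∘ φ) (a • v) t) : HasDerivAt φ a t := by
  have hbound : (fun r => φ r - φ t) =O[𝓝 t] fun r => r - t :=
    ((HasDerivAtFilter.isTheta_sub hc hv).isBigO_symm.comp_tendsto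
      (Tendsto.prodMk hφ tendsto_const_pure)).trans hcφ.isBigO_sub
  have hlin := (hasDerivAt_iff_isLittleO.1 hc).comp_tendsto hφ
  have hsmul := (hasDerivAt_iff_isLittleO.1 hcφ).sub (hlin.trans_isBigO hbound)
  have hdiff : (fun r => (φ r - φ t - (r - t) • a) • v) =o[𝓝 t] fun r => r - t :=
    hsmul.congr_left fun r => by
      simp only [Function.comp_apply, smul_eq_mul, sub_smul, mul_smul]
      abel
  refine hasDerivAt_iff_isLittleO.2 (Asymptotics.IsLittleO.of_norm_left ?_)
  refine (Asymptotics.isLittleO_const_mul_left_iff' (norm_ne_zero_iff.2 hv).isUnit).1 ?_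
  exact hdiff.norm_left.congr_left fun r => by rw [norm_smul, mul_comm]

theorem eventually_eq_of_hasDerivAt_zero [CompleteSpace E] {f : ℝ → E} {t₀ : ℝ}
    (hf : ∀ᶠ t in 𝓝 t₀, ContinuousAt f t) (hd : ∀ᶠ t in 𝓝[≠] t₀, HasDerivAt f 0 t) :
    ∀ᶠ t in 𝓝 t₀, f t = f t₀ := by
  obtain ⟨ε, hε, hball⟩ :=
    Metric.eventually_nhds_iff_ball.1 (hf.and (eventually_nhdsWithin_iff.1 hd))
  filter_upwards [Metric.ball_mem_nhds t₀ hε] with t ht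
  have hsub : uIcc t₀ t ⊆ Metric.ball t₀ ε :=
    (convex_ball t₀ ε).ordConnected.uIcc_subset (Metric.mem_ball_self hε) ht
  have hint := MeasureTheory.integral_eq_of_hasDerivAt_off_countable f (fun _ => 0)
    (countable_singleton t₀) (fun r hr => (hball r (hsub hr)).1.continuousWithinAt)
    (fun r hr => (hball r (hsub (Ioo_subset_Icc_self hr.1))).2 hr.2) intervalIntegrable_const
  rw [intervalIntegral.integral_zero] at hint
  exact sub_eq_zero.1 hint.symm

theorem eventually_eq_add_of_hasDerivAt {c c₂ : ℝ → E} {φ : ℝ → ℝ} {t₀ : ℝ}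
    (hφ : ∀ᶠ t in 𝓝 t₀, ContinuousAt φ t) (hc : ∀ᶠ t in 𝓝 t₀, c (φ t) = c₂ t)
    (hd : ∀ᶠ t in 𝓝[≠] t₀, ∃ v ≠ 0, HasDerivAt c v (φ t) ∧ HasDerivAt c₂ v t) :
    ∀ᶠ t in 𝓝 t₀, φ t = φ t₀ + (t - t₀) := by
  have hsub : ∀ᶠ t in 𝓝 t₀, φ t - t = φ t₀ - t₀ := by
    refine eventually_eq_of_hasDerivAt_zero (hφ.mono fun t ht => ht.sub continuousAt_id) ?_
    filter_upwards [hd, hφ.filter_mono nhdsWithin_le_nhds,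
      hc.eventually_nhds.filter_mono nhdsWithin_le_nhds] with t ⟨v, hv, hcv, hc₂v⟩ hφt hct
    have hone := hasDerivAt_of_hasDerivAt_comp (a := 1) hcv hv hφt
      ((one_smul ℝ v).symm ▸ hc₂v.congr_of_eventuallyEq hct)
    exact sub_self (1 : ℝ) ▸ hone.sub (hasDerivAt_id t)
  filter_upwards [hsub] with t ht
  linarith

theorem mul_sub_pos_of_hasDerivAt {f f' : ℝ → ℝ} {J : Set ℝ} {a b x : ℝ}
    (hJ : Convex ℝ J) (hf : ∀ u ∈ J, HasDerivAt f (f' u) u) (hne : ∀ u ∈ J, f' u ≠ 0) (hx : x ∈ J)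
    (hab : a < b) (hcont : ContinuousOn f (Icc a b)) (hsub : Ioo a b ⊆ J) :
    0 < f' x * (f b - f a) := by
  obtain ⟨u, hu, hslope⟩ :=
    exists_hasDerivAt_eq_slope f f' hab hcont fun u hu => hf u (hsub hu)
  rw [eq_div_iff (sub_pos.2 hab).ne'] at hslope
  rw [← hslope, ← mul_assoc]
  refine mul_pos ?_ (sub_pos.2 hab)
  rcases hasDerivWithinAt_forall_lt_or_forall_gt_of_forall_ne hJ
    (fun u hu => (hf u hu).hasDerivWithinAt) hne with h | h
  · exact mul_pos_of_neg_of_neg (h x hx) (h u (hsub hu))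
  · exact mul_pos (h x hx) (h u (hsub hu))

/- Between two times with equal values `f'` vanishes, hence at `s`; by Darboux it has constant sign
on either side of `s`, the same sign on both sides if it agrees at the two times, and then `f` is
monotone between them. -/
theorem injOn_prodMk_of_hasDerivAt {f f' : ℝ → ℝ} {J : Set ℝ} {s : ℝ} (hJ : J.OrdConnected)
    (hf : ∀ t ∈ J, HasDerivAt f (f' t) t) (hne : ∀ t ∈ J, t ≠ s → f' t ≠ 0) :
    InjOn (fun t => (f t, f' t)) J := by
  intro x hx y hy hxy
  wlog hlt : x < y generalizing x y
  · by_contra h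
    exact h (this hy hx hxy.symm (lt_of_le_of_ne (not_lt.1 hlt) (Ne.symm h))).symm
  exfalso
  obtain ⟨hval, hder⟩ := Prod.ext_iff.1 hxy
  have hsub : Icc x y ⊆ J := hJ.out hx hy
  have hcont : ContinuousOn f (Icc x y) := fun t ht =>
    (hf t (hsub ht)).continuousAt.continuousWithinAt
  obtain ⟨z, hz, hz0⟩ :=
    exists_hasDerivAt_eq_zero hlt hcont hval fun t ht => hf t (hsub (Ioo_subset_Icc_self ht))
  obtain rfl : z = s := by_contra fun h => hne z (hsub (Ioo_subset_Icc_self hz)) h hz0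
  have hleft : Ico x z ⊆ Icc x y := fun t ht => ⟨ht.1, (ht.2.trans hz.2).le⟩
  have hright : Ioc z y ⊆ Icc x y := fun t ht => ⟨(hz.1.trans ht.1).le, ht.2⟩
  have hpos_left : 0 < f' x * (f z - f x) :=
    mul_sub_pos_of_hasDerivAt (convex_Ico x z) (fun t ht => hf t (hsub (hleft ht)))
      (fun t ht => hne t (hsub (hleft ht)) ht.2.ne) ⟨le_rfl, hz.1⟩ hz.1
      (hcont.mono (Icc_subset_Icc_right hz.2.le)) Ioo_subset_Ico_self
  have hpos_right : 0 < f' y * (f y - f z) :=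
    mul_sub_pos_of_hasDerivAt (convex_Ioc z y) (fun t ht => hf t (hsub (hright ht)))
      (fun t ht => hne t (hsub (hright ht)) ht.1.ne') ⟨hz.2, le_rfl⟩ hz.2
      (hcont.mono (Icc_subset_Icc_left hz.1.le)) Ioo_subset_Ioc_self
  dsimp only at hval hder
  rw [← hval, ← hder] at hpos_right
  linarith [mul_sub (f' x) (f z) (f x), mul_sub (f' x) (f x) (f z)]

end Calculus

section Jet

theorem exists_continuousOn_injOn {X Y : Type*} [TopologicalSpace X] [TopologicalSpace Y]
    [Inhabited Y] {B : Set X} {e : ↥B → Y} (he : Continuous e) (hi : Function.Injective e) :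
    ∃ e' : X → Y, ContinuousOn e' B ∧ InjOn e' B := by
  have hext : B.domRestrict (Function.extend (↑) e fun _ => default) = e :=
    funext fun x => Subtype.val_injective.extend_apply e _ x
  refine ⟨Function.extend (↑) e fun _ => default, continuousOn_iff_continuous_domRestrict.2 ?_,
    injOn_iff_injective.2 ?_⟩
  · rwa [hext]
  · rwa [hext]

theorem IsSimplePoint.exists_continuousOn_injOn {A : Set Plane} {p : Plane}
    (h : IsSimplePoint A p) :
    ∃ V ∈ 𝓝 p, ∃ e : Plane → ℝ, ContinuousOn e (V ∩ A) ∧ InjOn e (V ∩ A) := by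
  obtain ⟨V, hV, hp, ⟨⟨e⟩⟩ | ⟨⟨e⟩⟩⟩ := h
  · exact ⟨V, hV.mem_nhds hp, PlaneCurve.exists_continuousOn_injOn e.continuous e.injective⟩
  · exact ⟨V, hV.mem_nhds hp, PlaneCurve.exists_continuousOn_injOn
      (continuous_subtype_val.comp e.continuous) (Subtype.val_injective.comp e.injective)⟩

/-- `σ` is the curve `(f, f')` of values and derivatives of a function `f`, and the zeros of `f'`
are isolated. -/
structure IsNondegenerateJet (σ : ℝ → Plane) : Prop where
  continuous : Continuous σ
  hasDerivAt : ∀ s, HasDerivAt (fun t => σ t 0) (σ s 1) s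
  eventually_ne_zero : ∀ s, ∀ᶠ t in 𝓝[≠] s, σ t 1 ≠ 0

namespace IsNondegenerateJet

variable {σ : ℝ → Plane} {s d P : ℝ}

theorem injOn_nhds (h : IsNondegenerateJet σ) (s : ℝ) : ∃ N ∈ 𝓝 s, InjOn σ N := by
  obtain ⟨l, u, hs, hlu⟩ :=
    mem_nhds_iff_exists_Ioo_subset.1 (eventually_nhdsWithin_iff.1 (h.eventually_ne_zero s))
  have hinj := injOn_prodMk_of_hasDerivAt (ordConnected_Ioo (a := l) (b := u))
    (fun t _ => h.hasDerivAt t) fun t ht hts => hlu ht hts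
  exact ⟨Ioo l u, Ioo_mem_nhds hs.1 hs.2, fun x hx y hy hxy => hinj hx hy (by simp only [hxy])⟩

theorem nhdsWithin_range_le (h : IsNondegenerateJet σ) (hs : σ s ∉ selfIntersections (range σ)) :
    𝓝[range σ] (σ s) ≤ map σ (𝓝 s) := by
  have hsimple : IsSimplePoint (range σ) (σ s) :=
    not_not.1 fun hsimple => hs ⟨mem_range_self s, hsimple⟩
  obtain ⟨V, hV, e, hec, hei⟩ := hsimple.exists_continuousOn_injOn
  obtain ⟨N, hN, hi⟩ := h.injOn_nhds s
  have hVs : σ ⁻¹' V ∈ 𝓝 s := h.continuous.continuousAt hV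
  have hmaps : MapsTo σ (N ∩ σ ⁻¹' V) (V ∩ range σ) := fun t ht => ⟨ht.2, mem_range_self t⟩
  rw [← nhdsWithin_inter_of_mem (mem_nhdsWithin_of_mem_nhds hV)]
  refine nhdsWithin_le_map_of_nhds_le_map_comp (hec _ ⟨mem_of_mem_nhds hV, mem_range_self s⟩) hei
    (mem_of_superset hVs fun t ht => ⟨ht, mem_range_self t⟩) ?_
  exact nhds_le_map_of_injOn (inter_mem hN hVs) (hec.comp h.continuous.continuousOn hmaps)
    (hei.comp (hi.mono inter_subset_left) hmaps)

/- Near a simple point the path is retraced by `σ ∘ φ = σ` for some continuous `φ`, and comparing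
derivatives of the first coordinates gives `φ' = 1`. -/
theorem eventually_add_eq (h : IsNondegenerateJet σ) (hs : σ s ∉ selfIntersections (range σ))
    (hd : σ (s + d) = σ s) : ∀ᶠ r in 𝓝 s, σ (r + d) = σ r := by
  obtain ⟨N, hN, hi⟩ := h.injOn_nhds (s + d)
  obtain ⟨φ, hφs, hφ⟩ := exists_continuousAt_lift hN h.continuous hi
    (h.nhdsWithin_range_le (hd ▸ hs)) h.continuous (.of_forall mem_range_self) hd.symm
  have htranslation : ∀ᶠ r in 𝓝 s, φ r = φ s + (r - s) := by
    refine eventually_eq_add_of_hasDerivAt (c := fun t => σ t 0) (c₂ := fun t => σ t 0)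
      (hφ.mono fun r hr => hr.2) (hφ.mono fun r hr => congrArg (· 0) hr.1) ?_
    filter_upwards [h.eventually_ne_zero s, hφ.filter_mono nhdsWithin_le_nhds] with r hr hφr
    exact ⟨σ r 1, hr, hφr.1 ▸ h.hasDerivAt (φ r), h.hasDerivAt r⟩
  filter_upwards [htranslation, hφ] with r hr hφr
  rw [← hφr.1, hr, hφs, show s + d + (r - s) = r + d by ring]

theorem isEdgePath (h : IsNondegenerateJet σ) (hP : 0 < P) (hper : Function.Periodic σ P)
    (hfin : (selfIntersections (range σ)).Finite) (hne : (selfIntersections (range σ)).Nonempty) :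
    IsEdgePath σ (selfIntersections (range σ)) P where
  pos := hP
  continuous := h.continuous
  periodic := hper
  finite_visits a b := by
    rw [inter_comm]
    exact finite_inter_preimage_of_injOn_nhds isCompact_Icc (fun s _ => h.injOn_nhds s) hfin
  nonempty_visits := by
    obtain ⟨_, hq⟩ := hne
    obtain ⟨s, rfl⟩ := hq.1
    exact ⟨s, hq⟩
  nhdsWithin_range_le := h.nhdsWithin_range_le
  retrace := h.eventually_add_eq

end IsNondegenerateJet

end Jet

section Plane

instance : Fact (Module.finrank ℝ Plane = 2) := ⟨finrank_euclideanSpace_fin⟩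

/-- The orientation of the plane in which the standard basis is positive. -/
noncomputable def planeOrientation : Orientation ℝ Plane (Fin 2) :=
  (EuclideanSpace.basisFun (Fin 2) ℝ).toBasis.orientation

/-- The rotation of the plane by a right angle. -/
noncomputable def quarterTurn : Plane ≃ₗᵢ[ℝ] Plane := planeOrientation.rightAngleRotation

theorem areaForm_planeOrientation (u v : Plane) : planeOrientation.areaForm u v = det2 u v := by
  rw [Orientation.areaForm_to_volumeForm,
    planeOrientation.volumeForm_robust (EuclideanSpace.basisFun (Fin 2) ℝ) rfl,
    Module.Basis.det_apply, Matrix.det_fin_two]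
  simp only [Module.Basis.toMatrix_apply, Matrix.cons_val_zero, Matrix.cons_val_one,
    Matrix.cons_val_fin_one, OrthonormalBasis.coe_toBasis_repr_apply,
    EuclideanSpace.basisFun_repr, det2, sub_right_inj]
  ring

theorem inner_quarterTurn_self (u : Plane) : inner ℝ (quarterTurn u) u = 0 :=
  planeOrientation.inner_rightAngleRotation_self u

theorem eq_det2_smul_quarterTurn {u w : Plane} (hu : ‖u‖ = 1) (huw : inner ℝ u w = 0) :
    w = det2 u w • quarterTurn u := by
  refine ext_inner_right ℝ fun y => ?_
  have hy := planeOrientation.inner_mul_inner_add_areaForm_mul_areaForm u w y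
  rw [huw, hu, zero_mul, zero_add, one_pow, one_mul] at hy
  rw [← hy, real_inner_smul_left, quarterTurn, Orientation.inner_rightAngleRotation_left,
    areaForm_planeOrientation]

variable {g g' : Plane ≃ᵃⁱ[ℝ] Plane}

theorem map_quarterTurn (hg : g ∈ SE2) (u : Plane) :
    g.linearIsometryEquiv (quarterTurn u) = quarterTurn (g.linearIsometryEquiv u) :=
  planeOrientation.linearIsometryEquiv_comp_rightAngleRotation _
    ((show _ = (1 : ℝ) from hg) ▸ one_pos) u

theorem exists_mem_SE2 (p q : Plane) {u v : Plane} (huv : ‖u‖ = ‖v‖) :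
    ∃ g ∈ SE2, g p = q ∧ g.linearIsometryEquiv u = v := by
  let R := planeOrientation.rotation (planeOrientation.oangle u v)
  refine ⟨R.toAffineIsometryEquiv.trans (AffineIsometryEquiv.constVAdd ℝ Plane (q - R p)),
    planeOrientation.det_rotation _, ?_,
    (planeOrientation.rotation_oangle_eq_iff_norm_eq u v).2 huv⟩
  simp

theorem eq_of_mem_SE2 (hg : g ∈ SE2) (hg' : g' ∈ SE2) {p u : Plane} (hu : u ≠ 0)
    (hp : g p = g' p) (hgu : g.linearIsometryEquiv u = g'.linearIsometryEquiv u) : g = g' := by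
  have hlin : g.linearIsometryEquiv = g'.linearIsometryEquiv := by
    refine LinearIsometryEquiv.toLinearEquiv_injective (LinearEquiv.toLinearMap_injective ?_)
    refine (planeOrientation.basisRightAngleRotation u hu).ext (Fin.forall_fin_two.2 ?_)
    have hquarter : g.linearIsometryEquiv (quarterTurn u) =
        g'.linearIsometryEquiv (quarterTurn u) := by
      rw [map_quarterTurn hg, map_quarterTurn hg', hgu]
    simpa [quarterTurn] using And.intro hgu hquarter
  ext1 x
  have hx := g.map_vadd p (x -ᵥ p)
  have hx' := g'.map_vadd p (x -ᵥ p)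
  rw [vsub_vadd] at hx hx'
  rw [hx, hx', hlin, hp]

theorem hasDerivAt_linearIsometryEquiv_comp (R : Plane ≃ₗᵢ[ℝ] Plane) {f : ℝ → Plane} {f' : Plane}
    {s : ℝ} (hf : HasDerivAt f f' s) : HasDerivAt (fun t => R (f t)) (R f') s :=
  R.toContinuousLinearEquiv.hasFDerivAt.comp_hasDerivAt s hf

theorem hasDerivAt_affineIsometryEquiv_comp (g : Plane ≃ᵃⁱ[ℝ] Plane) {f : ℝ → Plane} {f' : Plane}
    {s : ℝ} (hf : HasDerivAt f f' s) :
    HasDerivAt (fun t => g (f t)) (g.linearIsometryEquiv f') s :=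
  g.toContinuousAffineEquiv.toContinuousAffineMap.hasFDerivAt.comp_hasDerivAt s hf

end Plane

section Frenet

/-- `c` is parametrized by arc length, with unit tangent vector `T` and signed curvature `k`. -/
structure IsFrenetCurve (c T : ℝ → Plane) (k : ℝ → ℝ) : Prop where
  norm_tangent : ∀ s, ‖T s‖ = 1
  hasDerivAt : ∀ s, HasDerivAt c (T s) s
  hasDerivAt_tangent : ∀ s, HasDerivAt T (k s • quarterTurn (T s)) s

namespace IsFrenetCurve

variable {c c₁ c₂ T T₁ T₂ : ℝ → Plane} {k k₁ k₂ : ℝ → ℝ} {s : ℝ} {I : Set ℝ}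

theorem tangent_ne_zero (h : IsFrenetCurve c T k) (s : ℝ) : T s ≠ 0 :=
  norm_ne_zero_iff.1 ((h.norm_tangent s).symm ▸ one_ne_zero)

theorem map (h : IsFrenetCurve c T k) {g : Plane ≃ᵃⁱ[ℝ] Plane} (hg : g ∈ SE2) :
    IsFrenetCurve (fun s => g (c s)) (fun s => g.linearIsometryEquiv (T s)) k where
  norm_tangent s := (g.linearIsometryEquiv.norm_map _).trans (h.norm_tangent s)
  hasDerivAt s := hasDerivAt_affineIsometryEquiv_comp g (h.hasDerivAt s)
  hasDerivAt_tangent s := by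
    rw [← map_quarterTurn hg, ← map_smul]
    exact hasDerivAt_linearIsometryEquiv_comp _ (h.hasDerivAt_tangent s)

theorem comp_add_const (h : IsFrenetCurve c T k) (d : ℝ) :
    IsFrenetCurve (fun s => c (s + d)) (fun s => T (s + d)) fun s => k (s + d) where
  norm_tangent s := h.norm_tangent (s + d)
  hasDerivAt s := (h.hasDerivAt (s + d)).comp_add_const s d
  hasDerivAt_tangent s := (h.hasDerivAt_tangent (s + d)).comp_add_const s d

theorem eqOn_tangent (h₁ : IsFrenetCurve c₁ T₁ k₁) (h₂ : IsFrenetCurve c₂ T₂ k₂)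
    (hI : IsOpen I) (hI' : IsPreconnected I) (hs : s ∈ I) (hk : EqOn k₁ k₂ I)
    (hT : T₁ s = T₂ s) : EqOn T₁ T₂ I := by
  have hD : ∀ r ∈ I, HasDerivAt (fun r => T₁ r - T₂ r) (k₁ r • quarterTurn (T₁ r - T₂ r)) r := by
    intro r hr
    have hsub := (h₁.hasDerivAt_tangent r).sub (h₂.hasDerivAt_tangent r)
    rwa [← hk hr, ← smul_sub, ← map_sub] at hsub
  have hconst : ∀ r ∈ I, HasDerivAt (fun r => ‖T₁ r - T₂ r‖ ^ 2) 0 r := by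
    intro r hr
    have hnorm := (hD r hr).norm_sq
    rwa [real_inner_smul_right, real_inner_comm, inner_quarterTurn_self, mul_zero, mul_zero]
      at hnorm
  intro t ht
  have hnorm := hI.is_const_of_deriv_eq_zero hI'
    (fun r hr => (hconst r hr).differentiableAt.differentiableWithinAt)
    (fun r hr => (hconst r hr).deriv) ht hs
  rw [hT, sub_self, norm_zero, zero_pow two_ne_zero, sq_eq_zero_iff, norm_eq_zero] at hnorm
  exact sub_eq_zero.1 hnorm

theorem exists_mem_SE2 (h₁ : IsFrenetCurve c₁ T₁ k₁) (h₂ : IsFrenetCurve c₂ T₂ k₂)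
    (hI : IsOpen I) (hI' : IsPreconnected I) (hs : s ∈ I) (hk : EqOn k₁ k₂ I) :
    ∃ g ∈ SE2, ∀ t ∈ I, g (c₁ t) = c₂ t ∧ g.linearIsometryEquiv (T₁ t) = T₂ t := by
  obtain ⟨g, hg, hgc, hgT⟩ := PlaneCurve.exists_mem_SE2 (c₁ s) (c₂ s)
    ((h₁.norm_tangent s).trans (h₂.norm_tangent s).symm)
  have hT := (h₁.map hg).eqOn_tangent h₂ hI hI' hs hk hgT
  refine ⟨g, hg, fun t ht => ⟨?_, hT ht⟩⟩
  refine hI.eqOn_of_deriv_eq hI'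
    (fun r _ => ((h₁.map hg).hasDerivAt r).differentiableAt.differentiableWithinAt)
    (fun r _ => (h₂.hasDerivAt r).differentiableAt.differentiableWithinAt) (fun r hr => ?_)
    hs hgc ht
  rw [((h₁.map hg).hasDerivAt r).deriv, (h₂.hasDerivAt r).deriv]
  exact hT hr

theorem tangent_eventuallyEq (h₁ : IsFrenetCurve c₁ T₁ k₁) (h₂ : IsFrenetCurve c₂ T₂ k₂)
    (hc : c₁ =ᶠ[𝓝 s] c₂) : T₁ =ᶠ[𝓝 s] T₂ := by
  filter_upwards [hc.eventuallyEq_nhds] with t ht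
  exact (h₁.hasDerivAt t).unique ((h₂.hasDerivAt t).congr_of_eventuallyEq ht)

theorem curvature_eventuallyEq (h₁ : IsFrenetCurve c₁ T₁ k₁) (h₂ : IsFrenetCurve c₂ T₂ k₂)
    (hc : c₁ =ᶠ[𝓝 s] c₂) : k₁ =ᶠ[𝓝 s] k₂ := by
  filter_upwards [(h₁.tangent_eventuallyEq h₂ hc).eventuallyEq_nhds] with t ht
  have hsmul := (h₁.hasDerivAt_tangent t).unique
    ((h₂.hasDerivAt_tangent t).congr_of_eventuallyEq ht)
  rw [ht.eq_of_nhds] at hsmul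
  exact smul_left_injective ℝ (quarterTurn.map_eq_zero_iff.not.2 (h₂.tangent_ne_zero t)) hsmul

end IsFrenetCurve

end Frenet

section ArcLength

/-- `c` is an arc length parametrization, of period `P`, of the simple closed curve given by `γ`,
which is non-degenerate. Along `c` the tangent, the curvature and its derivative are the values of
`tangent γ` and `signatureMap γ` at the points of the curve. -/
structure IsArcLengthParam (γ c : ℝ → Plane) (P : ℝ) : Prop where
  isSimpleLoop : IsSimpleLoop c P
  curve_eq : curve γ = range c
  isFrenetCurve : IsFrenetCurve c (fun s => tangent γ (c s)) fun s => signatureMap γ (c s) 0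
  isNondegenerateJet : IsNondegenerateJet (signatureMap γ ∘ c)

theorem IsSimpleLoop.comp_orderIso {Y : Type*} [TopologicalSpace Y] {c : ℝ → Y} {L P : ℝ}
    (hc : IsSimpleLoop c L) (φ : ℝ ≃o ℝ) (hP : 0 < P) (hφ : ∀ s, φ (s + P) = φ s + L) :
    IsSimpleLoop (c ∘ φ) P where
  pos := hP
  continuous := hc.continuous.comp φ.continuous
  periodic s := by rw [Function.comp_apply, hφ, hc.periodic, Function.comp_apply]
  exists_int {s t} hst := by
    obtain ⟨n, hn⟩ := hc.exists_int hst
    have hint : φ (t + n * P) = φ t + n * L := by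
      simpa using AddConstMapClass.map_add_zsmul (⟨φ, hφ⟩ : AddConstMap ℝ ℝ P L) t n
    exact ⟨n, φ.injective (hn.trans hint.symm)⟩

theorem exists_orderIso_integral {v : ℝ → ℝ} {L : ℝ} (hv : Continuous v)
    (hper : Function.Periodic v L) (hpos : ∀ t, 0 < v t) (hL : 0 < L) :
    ∃ e : ℝ ≃o ℝ, ∀ t, e t = ∫ r in (0 : ℝ)..t, v r := by
  have hint : ∀ a b, IntervalIntegrable v MeasureTheory.volume a b := hv.intervalIntegrable
  have hderiv : ∀ t, HasDerivAt (fun t => ∫ r in (0 : ℝ)..t, v r) (v t) t :=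
    fun t => hv.integral_hasStrictDerivAt 0 t |>.hasDerivAt
  have hmono : StrictMono fun t => ∫ r in (0 : ℝ)..t, v r :=
    strictMono_of_deriv_pos fun t => (hderiv t).deriv ▸ hpos t
  have hsurj : Function.Surjective fun t => ∫ r in (0 : ℝ)..t, v r :=
    (continuous_iff_continuousAt.2 fun t => (hderiv t).continuousAt).surjective
      (hper.tendsto_atTop_intervalIntegral_of_pos' (hint 0 L) hpos hL)
      (hper.tendsto_atBot_intervalIntegral_of_pos' (hint 0 L) hpos hL)
  exact ⟨hmono.orderIsoOfSurjective _ hsurj, fun t => rfl⟩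

theorem exists_orderIso_hasDerivAt_inv {v : ℝ → ℝ} {L : ℝ} (hv : Continuous v)
    (hper : Function.Periodic v L) (hpos : ∀ t, 0 < v t) (hL : 0 < L) :
    ∃ (φ : ℝ ≃o ℝ) (P : ℝ), 0 < P ∧ φ 0 = 0 ∧ (∀ s, φ (s + P) = φ s + L) ∧
      ∀ s, HasDerivAt φ (v (φ s))⁻¹ s := by
  obtain ⟨e, he⟩ := exists_orderIso_integral hv hper hpos hL
  have he0 : e 0 = 0 := by rw [he, intervalIntegral.integral_same]
  have hadd : ∀ t, e (t + L) = e t + e L := by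
    intro t
    have hint : ∀ a b, IntervalIntegrable v MeasureTheory.volume a b := hv.intervalIntegrable
    rw [he, he, he, ← intervalIntegral.integral_add_adjacent_intervals (hint 0 t) (hint t (t + L)),
      hper.intervalIntegral_add_eq t 0, zero_add]
  have hderiv : ∀ t, HasDerivAt e (v t) t := by
    intro t
    rw [show ⇑e = fun t => ∫ r in (0 : ℝ)..t, v r from funext he]
    exact (hv.integral_hasStrictDerivAt 0 t).hasDerivAt
  refine ⟨e.symm, e L, he0 ▸ e.strictMono hL, e.symm_apply_eq.2 he0.symm, fun s => ?_, fun s => ?_⟩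
  · rw [e.symm_apply_eq, hadd, e.apply_symm_apply]
  · exact HasDerivAt.of_local_left_inverse e.symm.continuous.continuousAt (hderiv _) (hpos _).ne'
      (.of_forall e.apply_symm_apply)

theorem encard_pathPassages_comp_orderIso {X : Type*} {σ : ℝ → X} {Q E : Set X} {P : ℝ}
    (φ : ℝ ≃o ℝ) (hφ : φ 0 = 0) :
    (pathPassages (σ ∘ φ) Q P E).encard = (pathPassages σ Q (φ P) E).encard := by
  have hpre : pathPassages (σ ∘ φ) Q P E =
      φ.toEquiv.prodCongr φ.toEquiv ⁻¹' pathPassages σ Q (φ P) E := by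
    ext ⟨a, b⟩
    have hIco : φ a ∈ Ico 0 (φ P) ↔ a ∈ Ico 0 P := by
      rw [mem_Ico, mem_Ico, φ.lt_iff_lt, ← hφ, φ.le_iff_le, hφ]
    have himage : ∀ a b, Ioo (φ a) (φ b) = φ '' Ioo a b := fun a b => (φ.image_Ioo a b).symm
    simp only [pathPassages, IsGap, mem_ofPred_eq, mem_preimage, Equiv.prodCongr_apply,
      Prod.map_fst, Prod.map_snd, RelIso.coe_fn_toEquiv, hIco, himage, image_image,
      forall_mem_image, φ.lt_iff_lt, Function.comp_apply]
  rw [hpre, encard_preimage_of_bijective (Equiv.bijective _)]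

namespace IsSimpleClosed

variable {γ : ℝ → Plane} {L P : ℝ} {φ : ℝ ≃o ℝ}

theorem isSimpleLoop (h : IsSimpleClosed γ L) : IsSimpleLoop γ L where
  pos := h.pos
  continuous := h.contDiff.continuous
  periodic := h.periodic
  exists_int := h.exists_int

theorem signatureMap_comp (h : IsSimpleClosed γ L) : signatureMap γ ∘ γ = paramSignature γ :=
  funext h.signatureMap_apply

theorem speed_pos (h : IsSimpleClosed γ L) (t : ℝ) : 0 < ‖deriv γ t‖ :=
  norm_pos_iff.2 (h.regular t)

theorem contDiff_deriv (h : IsSimpleClosed γ L) : ContDiff ℝ 2 (deriv γ) :=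
  ContDiff.iterate_deriv' 2 1 h.contDiff

theorem contDiff_speed (h : IsSimpleClosed γ L) : ContDiff ℝ 2 fun t => ‖deriv γ t‖ :=
  h.contDiff_deriv.norm ℝ h.regular

theorem contDiff_curvature (h : IsSimpleClosed γ L) : ContDiff ℝ 1 (curvature γ) := by
  have hderiv : ContDiff ℝ 1 (deriv γ) := h.contDiff_deriv.of_le (by norm_num)
  have hderiv2 : ContDiff ℝ 1 (deriv (deriv γ)) := ContDiff.iterate_deriv' 1 1 h.contDiff_deriv
  have hspeed : ContDiff ℝ 1 fun t => ‖deriv γ t‖ := h.contDiff_speed.of_le (by norm_num)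
  rw [contDiff_euclidean] at hderiv hderiv2
  exact (((hderiv 0).mul (hderiv2 1)).sub ((hderiv 1).mul (hderiv2 0))).div (hspeed.pow 3)
    fun t => pow_ne_zero _ (h.speed_pos t).ne'

theorem hasDerivAt_curvature (h : IsSimpleClosed γ L) (t : ℝ) :
    HasDerivAt (curvature γ) (‖deriv γ t‖ * curvatureDot γ t) t := by
  rw [curvatureDot, mul_div_cancel₀ _ (h.speed_pos t).ne']
  exact (h.contDiff_curvature.differentiable one_ne_zero t).hasDerivAt

theorem continuous_curvatureDot (h : IsSimpleClosed γ L) : Continuous (curvatureDot γ) :=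
  (h.contDiff_curvature.continuous_deriv le_rfl).div h.contDiff_speed.continuous
    fun t => (h.speed_pos t).ne'

theorem continuous_paramSignature (h : IsSimpleClosed γ L) : Continuous (paramSignature γ) := by
  refine (PiLp.continuous_toLp 2 _).comp (continuous_pi (Fin.forall_fin_two.2 ⟨?_, ?_⟩))
  exacts [h.contDiff_curvature.continuous, h.continuous_curvatureDot]

theorem norm_paramTangent (h : IsSimpleClosed γ L) (t : ℝ) : ‖paramTangent γ t‖ = 1 :=
  norm_smul_inv_norm (𝕜 := ℝ) (h.regular t)

theorem hasDerivAt_paramTangent (h : IsSimpleClosed γ L) (t : ℝ) :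
    HasDerivAt (paramTangent γ)
      (‖deriv γ t‖ • curvature γ t • quarterTurn (paramTangent γ t)) t := by
  have hv := (h.speed_pos t).ne'
  obtain ⟨m, hm⟩ : ∃ m, HasDerivAt (fun t => ‖deriv γ t‖⁻¹) m t :=
    ⟨_, ((h.contDiff_speed.differentiable two_ne_zero t).inv hv).hasDerivAt⟩
  have hderiv : HasDerivAt (paramTangent γ)
      (‖deriv γ t‖⁻¹ • deriv (deriv γ) t + m • deriv γ t) t :=
    hm.smul (h.contDiff_deriv.differentiable two_ne_zero t).hasDerivAt
  have hortho : inner ℝ (paramTangent γ t)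
      (‖deriv γ t‖⁻¹ • deriv (deriv γ) t + m • deriv γ t) = 0 := by
    have hconst : (fun t => ‖paramTangent γ t‖ ^ 2) = fun _ => 1 :=
      funext fun r => by rw [h.norm_paramTangent, one_pow]
    have hzero := (hconst ▸ hderiv.norm_sq).unique (hasDerivAt_const t (1 : ℝ))
    exact (mul_eq_zero.1 hzero).resolve_left two_ne_zero
  have hdet : det2 (paramTangent γ t) (‖deriv γ t‖⁻¹ • deriv (deriv γ) t + m • deriv γ t) =
      ‖deriv γ t‖ * curvature γ t := by
    simp only [paramTangent, det2, curvature, PiLp.smul_apply, PiLp.add_apply, smul_eq_mul]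
    field_simp
    ring
  rwa [eq_det2_smul_quarterTurn (h.norm_paramTangent t) hortho, hdet, mul_smul] at hderiv

theorem eventually_curvatureDot_ne_zero (h : IsSimpleClosed γ L) (hnd : IsNondegenerate γ)
    (t : ℝ) : ∀ᶠ r in 𝓝[≠] t, curvatureDot γ r ≠ 0 := by
  by_cases h0 : curvatureDot γ t = 0
  · have hmem : ∀ r, curvatureDot γ r = 0 → γ r ∈ vertices γ := fun r hr =>
      ⟨mem_range_self r, by rwa [h.signatureMap_apply]⟩
    obtain ⟨U, hU, hUt⟩ := hnd (γ t) (hmem t h0)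
    obtain ⟨N, hN, hi⟩ := h.isSimpleLoop.injOn_nhds t
    have htU : γ t ∈ U := (hUt.ge (mem_singleton _)).1
    refine eventually_nhdsWithin_iff.2 ?_
    filter_upwards [h.contDiff.continuous.continuousAt (hU.mem_nhds htU), hN] with r hrU hrN hrt hr0
    exact hrt (hi hrN (mem_of_mem_nhds hN) (hUt.le ⟨hrU, hmem r hr0⟩))
  · exact eventually_nhdsWithin_of_eventually_nhds
      (h.continuous_curvatureDot.continuousAt.eventually_ne h0)

theorem isFrenetCurve_comp (h : IsSimpleClosed γ L)
    (hφ : ∀ s, HasDerivAt φ ‖deriv γ (φ s)‖⁻¹ s) :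
    IsFrenetCurve (γ ∘ φ) (paramTangent γ ∘ φ) (curvature γ ∘ φ) where
  norm_tangent s := h.norm_paramTangent (φ s)
  hasDerivAt s := (h.contDiff.differentiable three_ne_zero (φ s)).hasDerivAt.scomp s (hφ s)
  hasDerivAt_tangent s := by
    have hderiv := (h.hasDerivAt_paramTangent (φ s)).scomp s (hφ s)
    rwa [inv_smul_smul₀ (h.speed_pos _).ne'] at hderiv

theorem isNondegenerateJet_comp (h : IsSimpleClosed γ L) (hnd : IsNondegenerate γ)
    (hφ : ∀ s, HasDerivAt φ ‖deriv γ (φ s)‖⁻¹ s) :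
    IsNondegenerateJet (paramSignature γ ∘ φ) where
  continuous := h.continuous_paramSignature.comp φ.continuous
  hasDerivAt s := by
    have hderiv := (h.hasDerivAt_curvature (φ s)).scomp s (hφ s)
    rwa [smul_eq_mul, inv_mul_cancel_left₀ (h.speed_pos _).ne'] at hderiv
  eventually_ne_zero s := by
    have hne := eventually_nhdsWithin_iff.1 (h.eventually_curvatureDot_ne_zero hnd (φ s))
    refine eventually_nhdsWithin_iff.2 ?_
    filter_upwards [φ.continuous.continuousAt.eventually hne] with r hr hrs
    exact hr (φ.injective.ne hrs)

theorem exists_isArcLengthParam (h : IsSimpleClosed γ L) (hnd : IsNondegenerate γ) :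
    ∃ (φ : ℝ ≃o ℝ) (P : ℝ), φ 0 = 0 ∧ φ P = L ∧ IsArcLengthParam γ (γ ∘ φ) P := by
  obtain ⟨φ, P, hP, hφ0, hadd, hφ⟩ := exists_orderIso_hasDerivAt_inv h.contDiff_speed.continuous
    (fun t => congrArg norm (periodic_deriv h.periodic t)) h.speed_pos h.pos
  have htangent : (fun s => tangent γ ((γ ∘ φ) s)) = paramTangent γ ∘ φ :=
    funext fun s => h.tangent_apply (φ s)
  have hsig : signatureMap γ ∘ γ ∘ φ = paramSignature γ ∘ φ := by
    rw [← Function.comp_assoc, h.signatureMap_comp]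
  refine ⟨φ, P, hφ0, by simpa [hφ0] using hadd 0, h.isSimpleLoop.comp_orderIso φ hP hadd,
    (φ.surjective.range_comp γ).symm, ?_, ?_⟩
  · have hcurvature : (fun s => signatureMap γ ((γ ∘ φ) s) 0) = curvature γ ∘ φ :=
      funext fun s => congrArg (· 0) (congrFun hsig s)
    rw [htangent, hcurvature]
    exact h.isFrenetCurve_comp hφ
  · rw [hsig]
    exact h.isNondegenerateJet_comp hnd hφ

theorem multiplicity_eq (h : IsSimpleClosed γ L) (hφ : φ 0 = 0) (hφP : φ P = L) (E : Set Plane) :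
    multiplicity γ L E =
      (pathPassages (signatureMap γ ∘ γ ∘ φ) (quiverVertices γ) P E).encard := by
  rw [← Function.comp_assoc, encard_pathPassages_comp_orderIso φ hφ, h.signatureMap_comp, hφP,
    multiplicity]
  refine congrArg encard (ext fun I => ?_)
  simp only [passages, pathPassages, IsGap, mem_ofPred_eq, mem_preimage, and_assoc]

end IsSimpleClosed

theorem IsOpenSegment.of_comp_orderIso {f : ℝ → Plane} {A : Set Plane} {φ : ℝ ≃o ℝ}
    (h : IsOpenSegment (f ∘ φ) A) : IsOpenSegment f A := by
  obtain ⟨a, b, hab, rfl, ⟨e⟩⟩ := h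
  refine ⟨φ a, φ b, φ.strictMono hab, ?_, ⟨e.trans ?_⟩⟩
  · rw [image_comp, φ.image_Ioo]
  · exact (φ.toHomeomorph.image (Ioo a b)).trans (Homeomorph.setCongr (φ.image_Ioo a b))

end ArcLength

section LocalSymmetry

theorem mem_localSymmetries_iff {γ : ℝ → Plane} {p : Plane} {g : Plane ≃ᵃⁱ[ℝ] Plane} :
    g ∈ localSymmetries γ p ↔ g ∈ SE2 ∧ map g (𝓝[curve γ] p) = 𝓝[curve γ] (g p) ∧
      ∀ᶠ q in 𝓝[curve γ] p, g.linearIsometryEquiv (tangent γ q) = tangent γ (g q) := by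
  rw [g.isometry.isEmbedding.map_nhdsWithin_eq, nhdsWithin_eq_iff_eventuallyEq,
    eventually_nhdsWithin_iff, eventuallyEq_set]
  constructor
  · rintro ⟨hg, U, hU, hp, himage, htangent⟩
    rw [image_inter g.injective] at himage
    refine ⟨hg, ?_, ?_⟩
    · filter_upwards [(g.toHomeomorph.isOpenMap U hU).mem_nhds (mem_image_of_mem g hp)] with q hq
      exact ⟨fun hqg => (himage.subset ⟨hqg, hq⟩).1, fun hqc => (himage.superset ⟨hqc, hq⟩).1⟩
    · filter_upwards [hU.mem_nhds hp] with q hqU hq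
      exact htangent q ⟨hq, hqU⟩
  · rintro ⟨hg, himage, htangent⟩
    obtain ⟨U, hUsub, hU, hp⟩ := mem_nhds_iff.1
      ((g.continuous.continuousAt.eventually himage).and htangent)
    refine ⟨hg, U, hU, hp, ?_, fun q hq => (hUsub hq.2).2 hq.1⟩
    rw [image_inter g.injective]
    ext q
    refine and_congr_left ?_
    rintro ⟨r, hr, rfl⟩
    exact (hUsub hr).1

namespace IsArcLengthParam

variable {γ c : ℝ → Plane} {P s d : ℝ} {g : Plane ≃ᵃⁱ[ℝ] Plane}

theorem signature_eq (h : IsArcLengthParam γ c P) :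
    signature γ = range (signatureMap γ ∘ c) := by
  rw [signature, h.curve_eq, range_comp]

theorem mem_localSymmetries_of_eventually (h : IsArcLengthParam γ c P) (hg : g ∈ SE2)
    (hd : ∀ᶠ t in 𝓝 s, g (c t) = c (t + d)) : g ∈ localSymmetries γ (c s) := by
  have htangent := (h.isFrenetCurve.map hg).tangent_eventuallyEq
    (h.isFrenetCurve.comp_add_const d) hd
  rw [mem_localSymmetries_iff, h.curve_eq, ← h.isSimpleLoop.map_nhds_eq s, eventually_map]
  refine ⟨hg, ?_, ?_⟩
  · calc map g (map c (𝓝 s)) = map (c ∘ (· + d)) (𝓝 s) := by rw [map_map]; exact map_congr hd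
      _ = 𝓝[range c] (c (s + d)) := by
        rw [← map_map, map_add_right_nhds, h.isSimpleLoop.map_nhds_eq]
      _ = 𝓝[range c] (g (c s)) := by rw [hd.self_of_nhds]
  · filter_upwards [htangent, hd] with t ht htd
    rw [ht, htd]

theorem exists_eventually_apply_eq (h : IsArcLengthParam γ c P)
    (hg : g ∈ localSymmetries γ (c s)) : ∃ d, ∀ᶠ t in 𝓝 s, g (c t) = c (t + d) := by
  rw [mem_localSymmetries_iff, h.curve_eq, ← h.isSimpleLoop.map_nhds_eq s, eventually_map] at hg
  obtain ⟨-, hmap, htangent⟩ := hg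
  have hrange : ∀ᶠ t in 𝓝 s, g (c t) ∈ range c := hmap.le self_mem_nhdsWithin
  obtain ⟨s', hs'⟩ := hrange.self_of_nhds
  obtain ⟨N, hN, hi⟩ := h.isSimpleLoop.injOn_nhds s'
  obtain ⟨φ, hφs, hφ⟩ := exists_continuousAt_lift hN h.isSimpleLoop.continuous hi
    (h.isSimpleLoop.map_nhds_eq s').ge (g.continuous.comp h.isSimpleLoop.continuous) hrange hs'.symm
  have htranslation : ∀ᶠ t in 𝓝 s, φ t = φ s + (t - s) := by
    refine eventually_eq_add_of_hasDerivAt (c := c) (c₂ := fun t => g (c t))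
      (hφ.mono fun t ht => ht.2) (hφ.mono fun t ht => ht.1)
      (eventually_nhdsWithin_of_eventually_nhds ?_)
    filter_upwards [hφ, htangent] with t hφt ht
    have hderiv := h.isFrenetCurve.hasDerivAt (φ t)
    rw [hφt.1, Function.comp_apply, ← ht] at hderiv
    exact ⟨_, g.linearIsometryEquiv.map_eq_zero_iff.not.2 (h.isFrenetCurve.tangent_ne_zero t),
      hderiv, hasDerivAt_affineIsometryEquiv_comp g (h.isFrenetCurve.hasDerivAt t)⟩
  refine ⟨s' - s, ?_⟩
  filter_upwards [htranslation, hφ] with t ht hφt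
  rw [show t + (s' - s) = φ t by rw [ht, hφs]; ring, hφt.1, Function.comp_apply]

theorem signatureMap_apply_eq (h : IsArcLengthParam γ c P) (hg : g ∈ localSymmetries γ (c s)) :
    signatureMap γ (g (c s)) = signatureMap γ (c s) := by
  obtain ⟨d, hd⟩ := h.exists_eventually_apply_eq hg
  have hκ := (h.isFrenetCurve.map hg.1).curvature_eventuallyEq
    (h.isFrenetCurve.comp_add_const d) hd
  have hderiv := ((h.isNondegenerateJet.hasDerivAt s).congr_of_eventuallyEq hκ.symm).unique
    ((h.isNondegenerateJet.hasDerivAt (s + d)).comp_add_const s d)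
  rw [hd.self_of_nhds]
  ext i
  fin_cases i
  exacts [hκ.self_of_nhds.symm, hderiv.symm]

theorem exists_mem_localSymmetries (h : IsArcLengthParam γ c P)
    (hs : signatureMap γ (c s) ∉ quiverVertices γ)
    (hd : signatureMap γ (c (s + d)) = signatureMap γ (c s)) :
    ∃ g ∈ localSymmetries γ (c s), g (c s) = c (s + d) := by
  rw [quiverVertices, h.signature_eq] at hs
  obtain ⟨a, b, hsab, hab⟩ := mem_nhds_iff_exists_Ioo_subset.1
    (h.isNondegenerateJet.eventually_add_eq hs hd)
  obtain ⟨g, hg, hgc⟩ := h.isFrenetCurve.exists_mem_SE2 (h.isFrenetCurve.comp_add_const d)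
    isOpen_Ioo isPreconnected_Ioo hsab fun t ht => congrArg (· 0) (hab ht).symm
  refine ⟨g, h.mem_localSymmetries_of_eventually (d := d) hg ?_, (hgc s hsab).1⟩
  filter_upwards [Ioo_mem_nhds hsab.1 hsab.2] with t ht using (hgc t ht).1

theorem injOn_localSymmetries (h : IsArcLengthParam γ c P) (s : ℝ) :
    InjOn (fun g => g (c s)) (localSymmetries γ (c s)) := by
  intro g hg g' hg' hgg'
  have htangent : ∀ {g}, g ∈ localSymmetries γ (c s) →
      g.linearIsometryEquiv (tangent γ (c s)) = tangent γ (g (c s)) := by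
    rintro g ⟨-, U, -, hU, -, htangent⟩
    exact htangent _ ⟨h.curve_eq ▸ mem_range_self s, hU⟩
  refine eq_of_mem_SE2 hg.1 hg'.1 (h.isFrenetCurve.tangent_ne_zero s) hgg' ?_
  rw [htangent hg, htangent hg']
  exact congrArg (tangent γ) hgg'

theorem image_localSymmetries (h : IsArcLengthParam γ c P)
    (hs : signatureMap γ (c s) ∉ quiverVertices γ) :
    (fun g => g (c s)) '' localSymmetries γ (c s) =
      signaturePreimage γ {signatureMap γ (c s)} := by
  apply Subset.antisymm
  · rintro _ ⟨g, hg, rfl⟩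
    obtain ⟨d, hd⟩ := h.exists_eventually_apply_eq hg
    exact ⟨h.curve_eq.superset ⟨s + d, hd.self_of_nhds.symm⟩, h.signatureMap_apply_eq hg⟩
  · rintro q ⟨hq, hqs⟩
    rw [h.curve_eq] at hq
    obtain ⟨t, rfl⟩ := hq
    obtain ⟨g, hg, hgs⟩ := h.exists_mem_localSymmetries (d := t - s) hs
      (by rwa [add_sub_cancel])
    exact ⟨g, hg, hgs.trans (by rw [add_sub_cancel])⟩

theorem symIndexAt_eq_sigIndexAt (h : IsArcLengthParam γ c P)
    (hs : signatureMap γ (c s) ∉ quiverVertices γ) :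
    symIndexAt γ (c s) = sigIndexAt γ (c s) := by
  rw [symIndexAt, sigIndexAt, ← h.image_localSymmetries hs,
    (h.injOn_localSymmetries s).encard_image]

end IsArcLengthParam

end LocalSymmetry

section Quiver

namespace IsEdgePath

variable {σ c : ℝ → Plane} {τ : Plane → Plane} {Q E : Set Plane} {P a b : ℝ} {I : ℝ × ℝ}

theorem isOpenSegment (h : IsEdgePath σ Q P) (hI : I ∈ pathPassages σ Q P E) :
    IsOpenSegment σ E := by
  obtain ⟨-, hg, rfl⟩ := hI
  exact ⟨I.1, I.2, hg.1, rfl, h.nonempty_homeomorph_image_Ioo hg⟩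

theorem isOpenSegment_image_Ioo (h : IsEdgePath (τ ∘ c) Q P) (hc : IsSimpleLoop c P)
    (hg : IsGap (τ ∘ c ⁻¹' Q) a b) : IsOpenSegment c (c '' Ioo a b) :=
  ⟨a, b, hg.1, rfl, hc.nonempty_homeomorph_image_Ioo (h.gap_le_add_period hg)⟩

end IsEdgePath

namespace IsArcLengthParam

variable {γ c : ℝ → Plane} {P s : ℝ} {Q E : Set Plane} {I I' : ℝ × ℝ}

theorem isEdgePath (h : IsArcLengthParam γ c P) (hfin : (quiverVertices γ).Finite)
    (hne : (quiverVertices γ).Nonempty) :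
    IsEdgePath (signatureMap γ ∘ c) (quiverVertices γ) P := by
  rw [quiverVertices, h.signature_eq] at hfin hne ⊢
  exact h.isNondegenerateJet.isEdgePath h.isSimpleLoop.pos (h.isSimpleLoop.periodic.comp _) hfin hne

theorem quiverEdges_eq (h : IsArcLengthParam γ c P)
    (hpath : IsEdgePath (signatureMap γ ∘ c) (quiverVertices γ) P) :
    quiverEdges γ = {E | (pathPassages (signatureMap γ ∘ c) (quiverVertices γ) P E).Nonempty} := by
  rw [quiverEdges, components, h.signature_eq, hpath.image_connectedComponentIn]

theorem components_signaturePreimage (h : IsArcLengthParam γ c P)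
    (hpath : IsEdgePath (signatureMap γ ∘ c) Q P)
    (hE : (pathPassages (signatureMap γ ∘ c) Q P E).Nonempty) :
    components (signaturePreimage γ E) =
      (fun I => c '' Ioo I.1 I.2) '' pathPassages (signatureMap γ ∘ c) Q P E := by
  have hpre : signaturePreimage γ E = range c ∩ signatureMap γ ⁻¹' E := h.curve_eq ▸ rfl
  rw [components, hpre, hpath.image_connectedComponentIn_preimage h.isSimpleLoop hE]

theorem congruent (h : IsArcLengthParam γ c P) (hpath : IsEdgePath (signatureMap γ ∘ c) Q P)
    (hI : I ∈ pathPassages (signatureMap γ ∘ c) Q P E)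
    (hI' : I' ∈ pathPassages (signatureMap γ ∘ c) Q P E) :
    Congruent γ (c '' Ioo I.1 I.2) (c '' Ioo I'.1 I'.2) := by
  obtain ⟨-, hgap, rfl⟩ := hI
  obtain ⟨d, rfl, hd⟩ := hpath.exists_eq_add_of_mem_pathPassages hgap hI'
  obtain ⟨s, hs⟩ := nonempty_Ioo.2 hgap.1
  obtain ⟨g, hg, hgc⟩ := h.isFrenetCurve.exists_mem_SE2 (h.isFrenetCurve.comp_add_const d)
    isOpen_Ioo isPreconnected_Ioo hs fun t ht => congrArg (· 0) (hd t (Ioo_subset_Icc_self ht)).symm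
  refine ⟨g, hg, ?_, ?_⟩
  · rw [← image_add_const_Ioo, image_image, image_image]
    exact image_congr fun t ht => (hgc t ht).1
  · rintro _ ⟨t, ht, rfl⟩
    rw [(hgc t ht).1, (hgc t ht).2]

theorem sigIndexAt_eq (h : IsArcLengthParam γ c P)
    (hpath : IsEdgePath (signatureMap γ ∘ c) Q P)
    (hI : I ∈ pathPassages (signatureMap γ ∘ c) Q P E) (hs : s ∈ Ioo I.1 I.2) :
    sigIndexAt γ (c s) = (pathPassages (signatureMap γ ∘ c) Q P E).encard := by
  obtain ⟨-, hg, rfl⟩ := hI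
  rw [← hpath.encard_fibre_eq h.isSimpleLoop hg hs, ← h.curve_eq]
  rfl

theorem isLeast_sigIndex (h : IsArcLengthParam γ c P)
    (hpath : IsEdgePath (signatureMap γ ∘ c) (quiverVertices γ) P) :
    IsLeast ((fun E => (pathPassages (signatureMap γ ∘ c) (quiverVertices γ) P E).encard) ''
      quiverEdges γ) (sigIndex γ) := by
  have hleast := hpath.isLeast_iInf_encard_fibre h.isSimpleLoop
  rwa [← h.quiverEdges_eq hpath, ← h.curve_eq] at hleast

end IsArcLengthParam

end Quiver

end PlaneCurve

theorem mainTheorem5 (γ : ℝ → PlaneCurve.Plane) (L : ℝ)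
    (hγ : PlaneCurve.IsSimpleClosed γ L)
    (hnd : PlaneCurve.IsNondegenerate γ)
    (hfin : (PlaneCurve.quiverVertices γ).Finite)
    (hne : (PlaneCurve.quiverVertices γ).Nonempty) :
    (PlaneCurve.quiverEdges γ).Finite ∧
    (∀ E ∈ PlaneCurve.quiverEdges γ,
      PlaneCurve.IsOpenSegment (PlaneCurve.paramSignature γ) E ∧
      PlaneCurve.multiplicity γ L E ≠ ⊤ ∧
      (PlaneCurve.components (PlaneCurve.signaturePreimage γ E)).encard
        = PlaneCurve.multiplicity γ L E ∧
      (∀ C ∈ PlaneCurve.components (PlaneCurve.signaturePreimage γ E),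
        PlaneCurve.IsOpenSegment γ C ∧
        (∀ C' ∈ PlaneCurve.components (PlaneCurve.signaturePreimage γ E),
          PlaneCurve.Congruent γ C C') ∧
        (∀ p ∈ C,
          PlaneCurve.sigIndexAt γ p = PlaneCurve.multiplicity γ L E ∧
          PlaneCurve.symIndexAt γ p = PlaneCurve.multiplicity γ L E))) ∧
    IsLeast {m | ∃ E ∈ PlaneCurve.quiverEdges γ, m = PlaneCurve.multiplicity γ L E}
      (PlaneCurve.sigIndex γ) := by
  obtain ⟨φ, P, hφ, hφP, h⟩ := hγ.exists_isArcLengthParam hnd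
  have hpath := h.isEdgePath hfin hne
  have hσ : PlaneCurve.signatureMap γ ∘ γ ∘ φ = PlaneCurve.paramSignature γ ∘ φ := by
    rw [← Function.comp_assoc, hγ.signatureMap_comp]
  have hedges := h.quiverEdges_eq hpath
  simp only [hγ.multiplicity_eq hφ hφP]
  refine ⟨hedges ▸ hpath.finite_edges, fun E hE => ?_, ?_⟩
  · rw [hedges] at hE
    refine ⟨?_, (hpath.finite_pathPassages E).encard_lt_top.ne, ?_, ?_⟩
    · exact (hσ ▸ hpath.isOpenSegment hE.some_mem).of_comp_orderIso
    · rw [h.components_signaturePreimage hpath hE,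
        (hpath.injOn_image_Ioo h.isSimpleLoop).encard_image]
    · rw [h.components_signaturePreimage hpath hE]
      rintro _ ⟨I, hI, rfl⟩
      refine ⟨(hpath.isOpenSegment_image_Ioo h.isSimpleLoop hI.2.1).of_comp_orderIso, ?_, ?_⟩
      · exact forall_mem_image.2 fun I' hI' => h.congruent hpath hI hI'
      · rintro _ ⟨s, hs, rfl⟩
        rw [h.symIndexAt_eq_sigIndexAt (hI.2.1.2.2.2 s hs), h.sigIndexAt_eq hpath hI hs]
        exact ⟨rfl, rfl⟩
  · simpa only [image, eq_comm] using h.isLeast_sigIndex hpath
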